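/- Let $m \ge 1$ be an integer and let $\mathcal C$ be the skeleton of $\mathrm{FI}^m$ whose objects are the tuples $\mathbf n = ([n_1],\dots,[n_m])$ with $n_i \in \mathbb N$, where $[n_i]=\{1,\dots,n_i\}$, and whose morphisms $\mathbf n \to \mathbf t$ are the tuples of injections $[n_i] \to [t_i]$; put $\deg(\mathbf n) = n_1 + \dots + n_m$, and write $\mathbf j<\mathbf n$ if $j_i \le n_i$ for all $i$ and $\mathbf j \ne \mathbf n$. Let $k$ be a commutative ring. A $\mathcal C$-module is a functor from $\mathcal C$ to $k$-modules. Let $\mathfrak m$ be the two-sided ideal of the category algebra $k\mathcal C$ spanned by the morphisms $\mathbf j \to \mathbf n$ with $\mathbf j < \mathbf n$. For a $\mathcal C$-module $V$ and $s \ge 0$ put $H_s(V) = \operatorname{Tor}_s^{k\mathcal C}(k\mathcal C/\mathfrak m, V)$, so that $H_s$ is the $s$-th left derived functor of $V \mapsto k\mathcal C/\mathfrak m\otimes_{k\mathcal C}V = V/\mathfrak m V$, and let $\operatorname{gd}(V) = \sup\{\deg(\mathbf n) \mid H_0(V)_{\mathbf n} \ne 0\}$, which is $-1$ if this set is empty.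 Let $M(\mathbf n) = k[\mathcal C(\mathbf n, -)]$ and $S_{\mathbf n} = \operatorname{End}_{\mathcal C}(\mathbf n) \cong S_{n_1} \times \dots \times S_{n_m}$. A $\mathcal C$-module is called basic relative projective if it is isomorphic to $M(\mathbf n) \otimes_{kS_{\mathbf n}} U$ for some object $\mathbf n$ and some $kS_{\mathbf n}$-module $U$, and relative projective ($\sharp$-filtered) if it has a finite filtration $0 = V^0 \subseteq V^1 \subseteq \dots \subseteq V^r = V$ by submodules all of whose factors $V^{i+1}/V^i$ are basic relative projective. **Theorem.** Let $V$ be a $\mathcal C$-module over a commutative ring $k$ with $\operatorname{gd}(V) < \infty$. Then the following statements are equivalent: 1. $V$ is relative projective; 2. $H_s(V) = 0$ for all $s \ge 1$; 3. $H_1(V) = 0$; 4. $H_s(V) = 0$ for some $s \ge 1$. -/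

import Mathlib

open CategoryTheory CategoryTheory.Limits TensorProduct

universe u

noncomputable section

/-- The objects of the skeletal category `𝒞` of `FI^m`: the object with `size = (n₁, …, n_m)` stands
for the `m`-tuple of finite sets `([n₁], …, [n_m])`. -/
@[ext]
structure FIm (m : ℕ) where
  /-- The cardinalities of the `m` finite sets. -/
  size : Fin m → ℕ

namespace FIm

variable {m : ℕ}

/-- Morphisms `n ⟶ t` are `m`-tuples of injections `[n_i] → [t_i]`. -/
instance : SmallCategory (FIm m) where
  Hom n t := ∀ i, Fin (n.size i) ↪ Fin (t.size i)
  id n := fun i => Function.Embedding.refl (Fin (n.size i))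
  comp f g := fun i => (f i).trans (g i)

/-- The degree `n₁ + … + n_m` of an object. -/
def deg (n : FIm m) : ℕ := ∑ i, n.size i

variable (m) in
/-- The category of `FI^m`-modules over `k`: covariant functors from `𝒞` to `k`-modules. -/
abbrev Mod (k : Type u) [CommRing k] := FIm m ⥤ ModuleCat.{u} k

variable {k : Type u} [CommRing k]

/-- The category of `FI^m`-modules has enough projectives, so that left derived functors exist. -/
instance : EnoughProjectives (Mod m k) where
  presentation V := by
    let P : FIm m → Mod m k := fun n =>
      (evaluationLeftAdjoint (ModuleCat.{u} k) n).obj (Projective.over (V.obj n))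
    have hP : ∀ n, Projective (P n) := fun n =>
      (evaluationAdjunctionRight (ModuleCat.{u} k) n).map_projective _
        (Projective.projective_over (V.obj n))
    let q : ∀ n, P n ⟶ V := fun n =>
      ((evaluationAdjunctionRight (ModuleCat.{u} k) n).homEquiv _ _).symm (Projective.π (V.obj n))
    have : HasCoproduct P := inferInstance
    have hproj : Projective (∐ P) :=
      { factors := fun {E X} f e he =>
          ⟨Sigma.desc fun b => Projective.factorThru (Sigma.ι P b ≫ f) e, by
            apply Sigma.hom_ext
            intro b
            rw [Sigma.ι_desc_assoc, Projective.factorThru_comp]⟩ }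
    have happ : ∀ n, Epi ((Sigma.desc q).app n) := fun n => by
      have h : (evaluationAdjunctionRight (ModuleCat.{u} k) n).homEquiv _ _ (q n)
          = Projective.π (V.obj n) := Equiv.apply_symm_apply _ _
      rw [Adjunction.homEquiv_unit, ← Sigma.ι_desc q n] at h
      have h' : (((evaluationAdjunctionRight (ModuleCat.{u} k) n).unit.app
          (Projective.over (V.obj n))) ≫ (Sigma.ι P n).app n) ≫ (Sigma.desc q).app n
          = Projective.π (V.obj n) := by
        rw [Category.assoc]; exact h
      have : Epi ((((evaluationAdjunctionRight (ModuleCat.{u} k) n).unit.app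
          (Projective.over (V.obj n))) ≫ (Sigma.ι P n).app n) ≫ (Sigma.desc q).app n) := by
        rw [h']; exact Projective.π_epi _
      exact epi_of_epi ((((evaluationAdjunctionRight (ModuleCat.{u} k) n).unit.app
          (Projective.over (V.obj n))) ≫ (Sigma.ι P n).app n)) ((Sigma.desc q).app n)
    exact ⟨{ p := ∐ P, projective := hproj, f := Sigma.desc q
             epi := NatTrans.epi_of_epi_app _ }⟩

/-! ### Homology

Let `𝔪` be the two-sided ideal of the category algebra `k𝒞` spanned by all morphisms `j ⟶ n` with
`j < n`. The functor `k𝒞/𝔪 ⊗_{k𝒞} -` sends `V` to `V/𝔪V`, and its left derived functors are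
`H_s = Tor_s^{k𝒞}(k𝒞/𝔪, -)`. -/

/-- The value `(𝔪V)_n` of the submodule `𝔪V` of `V`: the submodule of `V_n` generated by the images
of all morphisms `j ⟶ n` with `j < n`. -/
def idealMul (V : Mod m k) (n : FIm m) : Submodule k (V.obj n) :=
  ⨆ (j : FIm m) (_ : j.size < n.size) (f : j ⟶ n), LinearMap.range (V.map f).hom

lemma size_le_of_hom {n t : FIm m} (f : n ⟶ t) : n.size ≤ t.size := fun i => by
  simpa using Fintype.card_le_of_embedding (f i)

lemma idealMul_le_comap_map (V : Mod m k) {n t : FIm m} (g : n ⟶ t) :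
    idealMul V n ≤ (idealMul V t).comap (V.map g).hom := by
  refine iSup_le fun j => iSup_le fun hj => iSup_le fun f => ?_
  rintro _ ⟨x, rfl⟩
  refine Submodule.mem_iSup_of_mem j (Submodule.mem_iSup_of_mem
    (lt_of_lt_of_le hj (size_le_of_hom g)) (Submodule.mem_iSup_of_mem (f ≫ g) ⟨x, ?_⟩))
  simp

lemma idealMul_le_comap_app {V W : Mod m k} (φ : V ⟶ W) (n : FIm m) :
    idealMul V n ≤ (idealMul W n).comap (φ.app n).hom := by
  refine iSup_le fun j => iSup_le fun hj => iSup_le fun f => ?_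
  rintro _ ⟨x, rfl⟩
  refine Submodule.mem_iSup_of_mem j (Submodule.mem_iSup_of_mem hj
    (Submodule.mem_iSup_of_mem f ⟨(φ.app j).hom x, ?_⟩))
  exact (NatTrans.naturality_apply φ f x).symm

/-- The quotient `FI^m`-module `V/𝔪V = k𝒞/𝔪 ⊗_{k𝒞} V`. -/
def quotObj (V : Mod m k) : Mod m k where
  obj n := ModuleCat.of k (V.obj n ⧸ idealMul V n)
  map g := ModuleCat.ofHom (Submodule.mapQ _ _ (V.map g).hom (idealMul_le_comap_map V g))
  map_id n := by
    ext x
    simp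
  map_comp f g := by
    ext x
    simp

variable (m k) in
/-- The functor `V ↦ V/𝔪V = k𝒞/𝔪 ⊗_{k𝒞} V`. -/
def quotFunctor : Mod m k ⥤ Mod m k where
  obj V := quotObj V
  map {V W} φ :=
    { app := fun n =>
        ModuleCat.ofHom (Submodule.mapQ _ _ (φ.app n).hom (idealMul_le_comap_app φ n))
      naturality := fun n t g => by
        ext x
        obtain ⟨x, rfl⟩ := Submodule.Quotient.mk_surjective _ x
        exact congrArg (Submodule.Quotient.mk (p := idealMul W t))
          (NatTrans.naturality_apply φ g x) }
  map_id V := by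
    ext n x
    simp [quotObj]
  map_comp φ ψ := by
    ext n x
    obtain ⟨x, rfl⟩ := Submodule.Quotient.mk_surjective _ x
    rfl

instance : (quotFunctor m k).Additive where
  map_add {V W f g} := by
    ext n x
    obtain ⟨x, rfl⟩ := Submodule.Quotient.mk_surjective _ x
    rfl

/-- The homology group `H_s(V) = Tor_s^{k𝒞}(k𝒞/𝔪, V)`, again an `FI^m`-module. -/
def homology (s : ℕ) (V : Mod m k) : Mod m k := ((quotFunctor m k).leftDerived s).obj V

/-- The homological degree `hd_s(V) = sup {deg n | H_s(V)_n ≠ 0}`; it is `-1` if that set is empty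
(and adding `-1` to a nonempty set of natural numbers does not change its supremum). -/
def hd (s : ℕ) (V : Mod m k) : EReal :=
  sSup (insert (-1) ((fun n : FIm m => ((n.deg : ℕ) : EReal)) ''
    {n | ¬ IsZero ((homology s V).obj n)}))

/-- The generating degree `gd(V) = hd_0(V)`. -/
def gd (V : Mod m k) : EReal := hd 0 V

/-! ### Relative projective modules -/

variable (k) in
/-- The free module `M(n)`: the `k`-linearization of the representable functor `𝒞(n, -)`. -/
def free (n : FIm m) : Mod m k where
  obj t := ModuleCat.of k ((n ⟶ t) →₀ k)
  map g := ModuleCat.ofHom (Finsupp.lmapDomain k k (fun f => f ≫ g))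
  map_id t := by
    ext f
    simp
  map_comp g h := by
    ext f
    simp

variable (k) in
/-- The right action of `σ ∈ S_n = End n` on `M(n)_t`, given by precomposition `f ↦ f ∘ σ`. -/
def freeRight {n : FIm m} (σ : CategoryTheory.End n) (t : FIm m) :
    (free k n).obj t →ₗ[k] (free k n).obj t :=
  Finsupp.lmapDomain k k (fun f : n ⟶ t => (σ : n ⟶ n) ≫ f)

section Basic

variable (n : FIm m) {U : Type u} [AddCommGroup U] [Module k U]
  (ρ : Representation k (CategoryTheory.End n) U)

/-- The relations `(p · σ) ⊗ u = p ⊗ (σ u)`, for `σ ∈ S_n = End n`, which define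
`M(n)_t ⊗_{kS_n} U` as a quotient of `M(n)_t ⊗_k U`. -/
def basicRel (t : FIm m) : Submodule k ((free k n).obj t ⊗[k] U) :=
  Submodule.span k {z | ∃ (p : (free k n).obj t) (σ : CategoryTheory.End n) (u : U),
    z = freeRight k σ t p ⊗ₜ[k] u - p ⊗ₜ[k] ρ σ u}

lemma basicRel_le_comap {t t' : FIm m} (g : t ⟶ t') :
    basicRel n ρ t ≤ (basicRel n ρ t').comap (LinearMap.rTensor U ((free k n).map g).hom) := by
  refine Submodule.span_le.2 ?_
  rintro _ ⟨p, σ, u, rfl⟩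
  refine Submodule.subset_span ⟨((free k n).map g).hom p, σ, u, ?_⟩
  rw [map_sub, LinearMap.rTensor_tmul, LinearMap.rTensor_tmul]
  congr 2
  have h : ∀ p : (n ⟶ t) →₀ k,
      Finsupp.mapDomain (fun f => f ≫ g) (Finsupp.mapDomain (fun f => (σ : n ⟶ n) ≫ f) p) =
        Finsupp.mapDomain (fun f => (σ : n ⟶ n) ≫ f) (Finsupp.mapDomain (fun f => f ≫ g) p) := by
    intro p
    rw [← Finsupp.mapDomain_comp, ← Finsupp.mapDomain_comp]
    congr 1
  exact h p

/-- The basic relative projective module `M(n) ⊗_{kS_n} U` of a `kS_n`-module `U`, that is, of a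
`k`-linear representation `U` of the group `S_n = End n`. -/
def basic : Mod m k where
  obj t := ModuleCat.of k (((free k n).obj t ⊗[k] U) ⧸ basicRel n ρ t)
  map g := ModuleCat.ofHom
    (Submodule.mapQ _ _ (LinearMap.rTensor U ((free k n).map g).hom) (basicRel_le_comap n ρ g))
  map_id t := by
    apply ModuleCat.hom_ext
    apply LinearMap.ext
    intro x
    obtain ⟨x, rfl⟩ := Submodule.Quotient.mk_surjective _ x
    simp
  map_comp {t t' t''} f g := by
    apply ModuleCat.hom_ext
    apply LinearMap.ext
    intro x
    obtain ⟨x, rfl⟩ := Submodule.Quotient.mk_surjective _ x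
    simp [LinearMap.rTensor_comp]

end Basic

/-- A module is basic relative projective if it is isomorphic to some `M(n) ⊗_{kS_n} U`. -/
def IsBasicRelativeProjective (V : Mod m k) : Prop :=
  ∃ (n : FIm m) (U : ModuleCat.{u} k) (ρ : Representation k (CategoryTheory.End n) U),
    Nonempty (V ≅ basic n ρ)

/-- A module `V` is relative projective if it has a finite filtration
`0 = F 0 ⊆ F 1 ⊆ … ⊆ F r = V` by submodules all of whose factors `F (i + 1) / F i` are basic
relative projective. -/
def IsRelativeProjective (V : Mod m k) : Prop :=
  ∃ (r : ℕ) (F : ℕ → Subobject V) (hF : Monotone F), F 0 = ⊥ ∧ F r = ⊤ ∧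
    ∀ i < r, IsBasicRelativeProjective (cokernel (Subobject.ofLE _ _ (hF (Nat.le_succ i))))

end FIm

end

/-! Write `H_0(V)_n = V_n/(𝔪V)_n`. Everything rests on dimension shifting: if `0 → K → P → V → 0` is
exact with `P` projective, then `H_1(V) = ker (H_0(K) → H_0(P))` and `H_{s+2}(V) = H_{s+1}(K)`.
Homology is computed objectwise, and its value at `n` vanishes as soon as `V` is zero at every `j ≤
n`, so all arguments can be confined to a downward closed set of objects.

Relative projective implies acyclic. The group `S_n` acts freely on `𝒞(n, t)`, so `M(n) ⊗_{kS_n} U`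
is at each object a direct sum of copies of `U` and is exact in `U`. Covering `U` by a free
representation gives a projective cover whose kernel is again basic; since `H_0` of a basic module
lives only at `n`, `H_1` vanishes, and shifting gives the rest (`acyc_basic`). Filtrations are
handled by the long exact sequence.

`H_1(V) = 0` implies relative projective. Finite generating degree means that `V` is generated on a
finite downward closed set of objects. Remove an object `n` of maximal degree. The quotient of the
two generated submodules again has `H_1 = 0` and is generated at `n`; the kernel of its canonical
cover by a basic module is zero at `n` and has `H_0 = 0` elsewhere, so it vanishes by Nakayama. The
smaller submodule inherits `H_1 = 0` and the process continues (`peel`, `exists_filtration`).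

`H_s(V) = 0` for one `s ≥ 1` implies `H_1(V) = 0`. It suffices to pass from `H_2` to `H_1`, that is,
to show `K ∩ 𝔪P ⊆ 𝔪K` when `H_1(K) = 0`. A natural operator `V_n → V_{2n}`, the alternating sum over
all ways to send each point to one of its two copies, always kills `𝔪V`. When `H_1(V) = 0` its
kernel is exactly `𝔪V` (`mem_idealMul_of_alternating`), because peeling embeds `(V/𝔪V)_n` into a
basic module up to `2n`. So an element of `K ∩ 𝔪P` is killed in `P`, hence in `K`, hence lies in
`𝔪K`. -/

noncomputable section

namespace FIm

variable {m : ℕ} {k : Type u} [CommRing k]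

/-! ### Pointwise exactness and vanishing of homology -/

/-- `H_s(V)` vanishes at the object `n`. -/
def Acyc (s : ℕ) (V : Mod m k) (n : FIm m) : Prop := IsZero ((homology s V).obj n)

/-- Pointwise short exact sequences of `FI^m`-modules. -/
structure IsSES {A B C : Mod m k} (i : A ⟶ B) (p : B ⟶ C) : Prop where
  inj : ∀ t, Function.Injective (i.app t).hom
  surj : ∀ t, Function.Surjective (p.app t).hom
  exact : ∀ t, Function.Exact (i.app t).hom (p.app t).hom

lemma epi_of_surjective {V W : Mod m k} (f : V ⟶ W)
    (hf : ∀ t, Function.Surjective (f.app t).hom) : Epi f := by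
  have : ∀ t, Epi (f.app t) := fun t => (ModuleCat.epi_iff_surjective _).2 (hf t)
  exact NatTrans.epi_of_epi_app f

lemma surjective_of_epi {V W : Mod m k} (f : V ⟶ W) [Epi f] (t : FIm m) :
    Function.Surjective (f.app t).hom :=
  (ModuleCat.epi_iff_surjective _).1 inferInstance

lemma mono_of_injective {V W : Mod m k} (f : V ⟶ W)
    (hf : ∀ t, Function.Injective (f.app t).hom) : Mono f := by
  have : ∀ t, Mono (f.app t) := fun t => (ModuleCat.mono_iff_injective _).2 (hf t)
  exact NatTrans.mono_of_mono_app f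

lemma isZero_iff_acyc (s : ℕ) (V : Mod m k) : IsZero (homology s V) ↔ ∀ n, Acyc s V n :=
  Functor.isZero_iff _

/-- Exactness of a short complex of `FI^m`-modules can be checked on elements. -/
lemma exact_of_forall {S : ShortComplex (Mod m k)}
    (h : ∀ t (x : S.X₂.obj t), (S.g.app t).hom x = 0 → ∃ y, (S.f.app t).hom y = x) : S.Exact := by
  rw [S.exact_iff_isZero_homology, Functor.isZero_iff]
  intro t
  refine IsZero.of_iso ?_ (S.mapHomologyIso ((evaluation _ _).obj t)).symm
  rw [← ShortComplex.exact_iff_isZero_homology, ShortComplex.moduleCat_exact_iff]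
  exact h t

lemma forall_of_exact {S : ShortComplex (Mod m k)} (hS : S.Exact) (t : FIm m) (x : S.X₂.obj t)
    (hx : (S.g.app t).hom x = 0) : ∃ y, (S.f.app t).hom y = x := by
  have := hS.map ((evaluation (FIm m) (ModuleCat.{u} k)).obj t)
  rw [ShortComplex.moduleCat_exact_iff] at this
  exact this x hx

/-- Evaluation at `n` commutes with homology, so `H_{s+1}(V)_n` is the homology of the complex of
quotients by `𝔪`; cycles and boundaries are then lifted to elements of the resolution. -/
lemma acyc_succ_iff {V : Mod m k} (R : ProjectiveResolution V) (s : ℕ) (n : FIm m) :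
    Acyc (s + 1) V n ↔ ∀ x : (R.complex.X (s + 1)).obj n,
      ((R.complex.d (s + 1) s).app n).hom x ∈ idealMul (R.complex.X s) n →
      ∃ y : (R.complex.X (s + 2)).obj n,
        x - ((R.complex.d (s + 2) (s + 1)).app n).hom y ∈ idealMul (R.complex.X (s + 1)) n := by
  let D := ((quotFunctor m k).mapHomologicalComplex _).obj R.complex
  let S := D.sc' (s + 2) (s + 1) s
  have e1 : (homology (s + 1) V).obj n ≅ (D.homology (s + 1)).obj n :=
    (R.isoLeftDerivedObj (quotFunctor m k) (s + 1)).app n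
  have e2 : D.homology (s + 1) ≅ S.homology :=
    D.homologyIsoSc' (s + 2) (s + 1) s (by simp) (by simp)
  have e3 := S.mapHomologyIso ((evaluation (FIm m) (ModuleCat.{u} k)).obj n)
  have e := e1 ≪≫ e2.app n ≪≫ e3.symm
  rw [Acyc, e.isZero_iff, ← ShortComplex.exact_iff_isZero_homology,
    ShortComplex.moduleCat_exact_iff]
  constructor
  · intro h x hx
    obtain ⟨y, hy⟩ := h (Submodule.Quotient.mk x) ((Submodule.Quotient.mk_eq_zero _).2 hx)
    obtain ⟨y, rfl⟩ := Submodule.Quotient.mk_surjective _ y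
    refine ⟨y, ?_⟩
    rw [← Submodule.Quotient.eq]
    exact hy.symm
  · intro h x hx
    obtain ⟨x, rfl⟩ := Submodule.Quotient.mk_surjective _ x
    obtain ⟨y, hy⟩ := h x ((Submodule.Quotient.mk_eq_zero _).1 hx)
    exact ⟨Submodule.Quotient.mk y, ((Submodule.Quotient.eq _).2 hy).symm⟩

/-- The augmentation of a projective resolution. -/
def augmentation {V : Mod m k} (R : ProjectiveResolution V) : R.complex.X 0 ⟶ V := R.π.f 0

lemma d_comp_augmentation {V : Mod m k} (R : ProjectiveResolution V) :
    R.complex.d 1 0 ≫ augmentation R = 0 := R.complex_d_comp_π_f_zero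

lemma augmentation_surjective {V : Mod m k} (R : ProjectiveResolution V) (t : FIm m) :
    Function.Surjective ((augmentation R).app t).hom :=
  surjective_of_epi (R.π.f 0) t

lemma exact_augmentation {V : Mod m k} (R : ProjectiveResolution V) (t : FIm m)
    (x : (R.complex.X 0).obj t) (hx : ((augmentation R).app t).hom x = 0) :
    ∃ y, ((R.complex.d 1 0).app t).hom y = x :=
  forall_of_exact R.exact₀ t x hx

/-- Only the surjectivity of the comparison map `H_0(V) → V/𝔪V` is needed, and it follows because `V
↦ V/𝔪V` preserves surjections. -/
lemma idealMul_eq_top_of_acyc_zero {V : Mod m k} {n : FIm m} (h : Acyc 0 V n) :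
    idealMul V n = ⊤ := by
  let R := projectiveResolution V
  have h1 : Epi ((quotFunctor m k).map (augmentation R)) := by
    refine epi_of_surjective _ fun t x => ?_
    obtain ⟨x, rfl⟩ := Submodule.Quotient.mk_surjective _ x
    obtain ⟨y, rfl⟩ := augmentation_surjective R t x
    exact ⟨Submodule.Quotient.mk y, rfl⟩
  have h2 : Epi (R.fromLeftDerivedZero' (quotFunctor m k)) :=
    @epi_of_epi_fac _ _ _ _ _ _ _ _ h1
      (ProjectiveResolution.pOpcycles_comp_fromLeftDerivedZero' R (quotFunctor m k))
  have h3 : Epi ((quotFunctor m k).fromLeftDerivedZero.app V) := by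
    rw [ProjectiveResolution.fromLeftDerivedZero_eq R]
    exact epi_comp' (Iso.isIso_hom _).epi_of_iso (epi_comp' (Iso.isIso_hom _).epi_of_iso h2)
  have h4 : Subsingleton (((quotFunctor m k).leftDerived 0 |>.obj V).obj n) :=
    (ModuleCat.isZero_iff_subsingleton).1 h
  have h5 : Subsingleton (V.obj n ⧸ idealMul V n) :=
    (surjective_of_epi ((quotFunctor m k).fromLeftDerivedZero.app V) n).subsingleton
  exact (Submodule.Quotient.subsingleton_iff).1 h5

/-- Splicing a projective resolution of a syzygy. -/
def spliceResolution {K P V : Mod m k} [Projective P] {i : K ⟶ P} {p : P ⟶ V} (h : IsSES i p)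
    (R : ProjectiveResolution K) : ProjectiveResolution V where
  complex := R.complex.augment (augmentation R ≫ i)
    (by rw [← Category.assoc, d_comp_augmentation, zero_comp])
  projective n := by
    cases n with
    | zero => exact inferInstanceAs (Projective P)
    | succ n => exact R.projective n
  π := (ChainComplex.toSingle₀Equiv _ _).symm ⟨p, by
    ext t x
    exact (h.exact t).apply_apply_eq_zero _⟩
  quasiIso := ⟨fun n => by
    have hepi := epi_of_surjective p h.surj
    cases n with
    | zero =>
      rw [ChainComplex.quasiIsoAt₀_iff, ShortComplex.quasiIso_iff_of_zeros']
      · refine (ShortComplex.exact_and_epi_g_iff_of_iso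
          (S₂ := ShortComplex.mk (augmentation R ≫ i) p ?_) ?_).2 ⟨?_, hepi⟩
        · ext t x
          exact (h.exact t).apply_apply_eq_zero _
        · exact ShortComplex.isoMk (Iso.refl _) (Iso.refl _) (Iso.refl _)
            ((Category.id_comp _).trans (Category.comp_id _).symm)
            (by
              refine (Category.id_comp _).trans (Eq.trans ?_ (Category.comp_id _).symm)
              exact (ChainComplex.toSingle₀Equiv_symm_apply_f_zero
                (C := R.complex.augment (augmentation R ≫ i) _) p _).symm)
        · refine exact_of_forall fun t x hx => ?_
          obtain ⟨y, rfl⟩ := (h.exact t x).1 hx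
          obtain ⟨z, rfl⟩ := augmentation_surjective R t y
          exact ⟨z, rfl⟩
      all_goals rfl
    | succ n =>
      rw [quasiIsoAt_iff_exactAt']
      · rw [HomologicalComplex.exactAt_iff' _ (n + 1 + 1) (n + 1) n (by simp) (by simp)]
        cases n with
        | zero =>
          refine exact_of_forall fun t x hx => ?_
          -- The lowest differential is the augmentation of `R` followed by the injection `i`, so it
          -- has the same kernel as the augmentation.
          exact exact_augmentation R t x (h.inj t (Eq.trans hx (map_zero _).symm))
        | succ n => exact R.exact_succ n
      · apply ChainComplex.exactAt_succ_single_obj⟩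

/-! ### Dimension shifting -/

lemma idealMul_induction {V : Mod m k} {n : FIm m} {p : V.obj n → Prop} {x : V.obj n}
    (hx : x ∈ idealMul V n) (h0 : p 0) (hadd : ∀ x y, p x → p y → p (x + y))
    (h : ∀ (j : FIm m) (_ : j.size < n.size) (f : j ⟶ n) (y : V.obj j), p ((V.map f).hom y)) :
    p x := by
  have key : ∀ x ∈ idealMul V n, p x := by
    intro x hx
    refine Submodule.iSup_induction _ (motive := p) hx (fun j x hx => ?_) h0 hadd
    refine Submodule.iSup_induction _ (motive := p) hx (fun hj x hx => ?_) h0 hadd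
    refine Submodule.iSup_induction _ (motive := p) hx (fun f x hx => ?_) h0 hadd
    obtain ⟨y, rfl⟩ := hx
    exact h j hj f y
  exact key x hx

lemma map_mem_idealMul {V : Mod m k} {j n : FIm m} (hj : j.size < n.size) (f : j ⟶ n)
    (y : V.obj j) : (V.map f).hom y ∈ idealMul V n :=
  Submodule.mem_iSup_of_mem j (Submodule.mem_iSup_of_mem hj
    (Submodule.mem_iSup_of_mem f ⟨y, rfl⟩))

lemma app_mem_idealMul {V W : Mod m k} (φ : V ⟶ W) {n : FIm m} {x : V.obj n}
    (hx : x ∈ idealMul V n) : (φ.app n).hom x ∈ idealMul W n :=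
  idealMul_le_comap_app φ n hx

/-- A pointwise surjection maps `𝔪V` onto `𝔪W`. -/
lemma exists_mem_idealMul {V W : Mod m k} (φ : V ⟶ W)
    (hφ : ∀ t, Function.Surjective (φ.app t).hom) {n : FIm m} {y : W.obj n}
    (hy : y ∈ idealMul W n) : ∃ x ∈ idealMul V n, (φ.app n).hom x = y := by
  refine idealMul_induction (p := fun y => ∃ x ∈ idealMul V n, (φ.app n).hom x = y) hy ⟨0, Submodule.zero_mem _, map_zero _⟩ ?_ ?_
  · rintro _ _ ⟨x, hx, rfl⟩ ⟨y, hy, rfl⟩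
    exact ⟨x + y, Submodule.add_mem _ hx hy, map_add _ _ _⟩
  · intro j hj f y
    obtain ⟨x, rfl⟩ := hφ j y
    exact ⟨(V.map f).hom x, map_mem_idealMul hj f x, NatTrans.naturality_apply φ f x⟩

/-- This is `H_1(V) = ker (H_0(K) → H_0(P))`, read off from the resolution of `V` spliced from one
of `K`. -/
lemma acyc_one_iff {K P V : Mod m k} [Projective P] {i : K ⟶ P} {p : P ⟶ V} (h : IsSES i p)
    (n : FIm m) : Acyc 1 V n ↔
      ∀ x : K.obj n, (i.app n).hom x ∈ idealMul P n → x ∈ idealMul K n := by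
  let R := projectiveResolution K
  have key : Acyc 1 V n ↔ ∀ x : (R.complex.X 0).obj n,
      (i.app n).hom (((augmentation R).app n).hom x) ∈ idealMul P n →
      ∃ y : (R.complex.X 1).obj n,
        x - ((R.complex.d 1 0).app n).hom y ∈ idealMul (R.complex.X 0) n :=
    acyc_succ_iff (spliceResolution h R) 0 n
  rw [key]
  constructor
  · intro H x hx
    obtain ⟨y, rfl⟩ := augmentation_surjective R n x
    obtain ⟨z, hz⟩ := H y hx
    have := app_mem_idealMul (augmentation R) hz
    rw [map_sub] at this
    have h0 : ((augmentation R).app n).hom (((R.complex.d 1 0).app n).hom z) = 0 :=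
      congrArg (fun φ => (φ.app n).hom z) (d_comp_augmentation R)
    rwa [h0, sub_zero] at this
  · intro H x hx
    obtain ⟨y, hy, hyx⟩ := exists_mem_idealMul _ (augmentation_surjective R) (H _ hx)
    obtain ⟨z, hz⟩ := exact_augmentation R n (x - y) (by rw [map_sub, hyx]; exact sub_self _)
    refine ⟨z, ?_⟩
    rw [hz, sub_sub_cancel]
    exact hy

/-- In positive degrees the spliced resolution is the resolution of `K` shifted by one, so both
elementwise criteria coincide definitionally. -/
lemma acyc_succ_succ_iff {K P V : Mod m k} [Projective P] {i : K ⟶ P} {p : P ⟶ V}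
    (h : IsSES i p) (s : ℕ) (n : FIm m) : Acyc (s + 2) V n ↔ Acyc (s + 1) K n := by
  rw [acyc_succ_iff (spliceResolution h (projectiveResolution K)) (s + 1),
    acyc_succ_iff (projectiveResolution K) s]
  rfl

/-! ### Submodules and quotients of `FI^m`-modules -/

/-- A submodule of an `FI^m`-module, as a family of submodules of the values. -/
structure SubMod (V : Mod m k) where
  carrier : ∀ t, Submodule k (V.obj t)
  map_mem : ∀ {s t : FIm m} (f : s ⟶ t) (x : V.obj s), x ∈ carrier s →
    (V.map f).hom x ∈ carrier t

namespace SubMod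

variable {V : Mod m k}

/-- The `FI^m`-module underlying a submodule. -/
def toMod (N : SubMod V) : Mod m k where
  obj t := ModuleCat.of k (N.carrier t)
  map f := ModuleCat.ofHom ((V.map f).hom.restrict (fun x hx => N.map_mem f x hx))
  map_id t := by
    ext x
    exact congrArg (fun φ => φ.hom x.1) (V.map_id t)
  map_comp f g := by
    ext x
    exact congrArg (fun φ => φ.hom x.1) (V.map_comp f g)

/-- The inclusion of a submodule. -/
def ι (N : SubMod V) : N.toMod ⟶ V where
  app t := ModuleCat.ofHom (N.carrier t).subtype
  naturality s t f := by
    ext x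
    rfl

/-- The quotient of an `FI^m`-module by a submodule. -/
def quotient (N : SubMod V) : Mod m k where
  obj t := ModuleCat.of k (V.obj t ⧸ N.carrier t)
  map f := ModuleCat.ofHom (Submodule.mapQ _ _ (V.map f).hom (fun x hx => N.map_mem f x hx))
  map_id t := by
    apply ModuleCat.hom_ext
    apply LinearMap.ext
    intro x
    obtain ⟨x, rfl⟩ := Submodule.Quotient.mk_surjective _ x
    simp
  map_comp f g := by
    apply ModuleCat.hom_ext
    apply LinearMap.ext
    intro x
    obtain ⟨x, rfl⟩ := Submodule.Quotient.mk_surjective _ x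
    simp

/-- The projection onto the quotient by a submodule. -/
def π (N : SubMod V) : V ⟶ N.quotient where
  app t := ModuleCat.ofHom (N.carrier t).mkQ
  naturality s t f := by
    ext x
    rfl

lemma isSES (N : SubMod V) : IsSES N.ι N.π where
  inj _ := Subtype.val_injective
  surj t := (N.carrier t).mkQ_surjective
  exact t := LinearMap.exact_subtype_mkQ (N.carrier t)

end SubMod

/-- The kernel of a morphism, as a submodule. -/
def kerSub {V W : Mod m k} (φ : V ⟶ W) : SubMod V where
  carrier t := LinearMap.ker (φ.app t).hom
  map_mem {s t} f x hx := by
    rw [LinearMap.mem_ker] at hx ⊢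
    have := NatTrans.naturality_apply φ f x
    rw [hx, map_zero] at this
    exact this

lemma isSES_kerSub {V W : Mod m k} (φ : V ⟶ W)
    (hφ : ∀ t, Function.Surjective (φ.app t).hom) : IsSES (kerSub φ).ι φ where
  inj _ := Subtype.val_injective
  surj := hφ
  exact t := LinearMap.exact_subtype_ker_map (φ.app t).hom

/-! ### Consequences of the long exact sequence -/

section LongExact

variable {A B C : Mod m k} {i : A ⟶ B} {p : B ⟶ C}

/-- For a cover `q : P → B` and an exact sequence `A → B → C`, the exact sequence relating the
kernels of `P → B` and `P → C` to `A`. -/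
lemma exists_kernel_sequence (h : IsSES i p) : ∃ (P KB KC : Mod m k) (_ : Projective P)
    (a : KB ⟶ P) (q : P ⟶ B) (c : KC ⟶ P) (i' : KB ⟶ KC) (p' : KC ⟶ A),
    IsSES a q ∧ IsSES c (q ≫ p) ∧ IsSES i' p' ∧ i' ≫ c = a ∧ p' ≫ i = c ≫ q := by
  let P := Projective.over B
  let q : P ⟶ B := Projective.π B
  have hq : ∀ t, Function.Surjective (q.app t).hom := surjective_of_epi q
  have hqp : ∀ t, Function.Surjective ((q ≫ p).app t).hom := fun t => (h.surj t).comp (hq t)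
  have hi : Mono i := mono_of_injective i h.inj
  have hle : ∀ t (x : P.obj t), (q.app t).hom x = 0 → ((q ≫ p).app t).hom x = 0 := fun t x hx => by
    change (p.app t).hom ((q.app t).hom x) = 0
    rw [hx, map_zero]
  let KB := (kerSub q).toMod
  let KC := (kerSub (q ≫ p)).toMod
  let i' : KB ⟶ KC :=
    { app := fun t => ModuleCat.ofHom (Submodule.inclusion (fun x hx => hle t x hx))
      naturality := fun s t f => by
        ext x
        rfl }
  let S : ShortComplex (Mod m k) := ShortComplex.mk i p (by
    ext t x
    exact (h.exact t).apply_apply_eq_zero _)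
  have hS : S.Exact := exact_of_forall fun t x hx => (h.exact t x).1 hx
  have : Mono S.f := hi
  let p' : KC ⟶ A := hS.lift ((kerSub (q ≫ p)).ι ≫ q) (by
    ext t x
    exact x.2)
  have hp' : p' ≫ i = (kerSub (q ≫ p)).ι ≫ q := hS.lift_f _ _
  have hp'' : ∀ t (x : KC.obj t), (i.app t).hom ((p'.app t).hom x) = (q.app t).hom x.1 :=
    fun t x => congrArg (fun φ => (φ.app t).hom x) hp'
  refine ⟨P, KB, KC, inferInstance, (kerSub q).ι, q, (kerSub (q ≫ p)).ι, i', p',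
    isSES_kerSub q hq, isSES_kerSub _ hqp, ⟨fun t => Submodule.inclusion_injective (fun x hx => hle t x hx),
    fun t y => ?_, fun t x => ⟨fun hx => ?_, ?_⟩⟩, rfl, hp'⟩
  · obtain ⟨x, hx⟩ := hq t ((i.app t).hom y)
    refine ⟨⟨x, ?_⟩, h.inj t ?_⟩
    · change (p.app t).hom ((q.app t).hom x) = 0
      rw [hx]
      exact (h.exact t).apply_apply_eq_zero _
    · exact (hp'' t _).trans hx
  · refine ⟨⟨x.1, ?_⟩, rfl⟩
    have := hp'' t x
    rw [hx, map_zero] at this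
    exact this.symm
  · rintro ⟨y, rfl⟩
    apply h.inj t
    rw [hp'', map_zero]
    exact y.2

/-- Exactness of `H_1(C) → H_0(A) → H_0(B)`. -/
lemma mem_idealMul_of_acyc_one (h : IsSES i p) {n : FIm m} (hC : Acyc 1 C n) (a : A.obj n)
    (ha : (i.app n).hom a ∈ idealMul B n) : a ∈ idealMul A n := by
  obtain ⟨P, KB, KC, _, b, q, c, i', p', hB, hC', hK, e1, e2⟩ := exists_kernel_sequence h
  obtain ⟨y, rfl⟩ := hK.surj n a
  have e2' : ∀ y, (i.app n).hom ((p'.app n).hom y) = (q.app n).hom ((c.app n).hom y) :=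
    fun y => congrArg (fun φ => (φ.app n).hom y) e2
  have e1' : ∀ w, (c.app n).hom ((i'.app n).hom w) = (b.app n).hom w :=
    fun w => congrArg (fun φ => (φ.app n).hom w) e1
  rw [e2'] at ha
  obtain ⟨z, hz, hzy⟩ := exists_mem_idealMul q hB.surj ha
  -- Correcting `y` by `w ∈ KB` does not change its image in `A`, and moves it into `𝔪P`.
  obtain ⟨w, hw⟩ := (hB.exact n ((c.app n).hom y - z)).1 (by rw [map_sub, hzy, sub_self])
  have h1 : y - (i'.app n).hom w ∈ idealMul KC n := by
    refine (acyc_one_iff hC' n).1 hC _ ?_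
    rw [map_sub, e1', hw, sub_sub_cancel]
    exact hz
  have h2 := app_mem_idealMul p' h1
  rwa [map_sub, (hK.exact n).apply_apply_eq_zero, sub_zero] at h2

/-- Exactness of `H_1(B) → H_1(C) → H_0(A) → H_0(B)`. -/
lemma acyc_one_right (h : IsSES i p) {n : FIm m} (hB : Acyc 1 B n)
    (hA : ∀ a : A.obj n, (i.app n).hom a ∈ idealMul B n → a ∈ idealMul A n) : Acyc 1 C n := by
  obtain ⟨P, KB, KC, _, b, q, c, i', p', hB', hC', hK, e1, e2⟩ := exists_kernel_sequence h
  have e2' : ∀ y, (i.app n).hom ((p'.app n).hom y) = (q.app n).hom ((c.app n).hom y) :=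
    fun y => congrArg (fun φ => (φ.app n).hom y) e2
  have e1' : ∀ w, (c.app n).hom ((i'.app n).hom w) = (b.app n).hom w :=
    fun w => congrArg (fun φ => (φ.app n).hom w) e1
  rw [acyc_one_iff hC']
  intro y hy
  have h1 : (p'.app n).hom y ∈ idealMul A n := hA _ (by rw [e2']; exact app_mem_idealMul q hy)
  obtain ⟨y', hy', hyy⟩ := exists_mem_idealMul p' hK.surj h1
  obtain ⟨w, hw⟩ := (hK.exact n (y - y')).1 (by rw [map_sub, hyy, sub_self])
  have h2 : w ∈ idealMul KB n := by
    refine (acyc_one_iff hB' n).1 hB _ ?_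
    rw [← e1', hw, map_sub]
    exact Submodule.sub_mem _ hy (app_mem_idealMul c hy')
  have h3 := app_mem_idealMul i' h2
  rw [hw] at h3
  simpa using Submodule.add_mem _ h3 hy'

/-- An element of `KB ∩ 𝔪P` lies in `𝔪KC` because `H_1(C) = 0`, and then in `𝔪KB` because `H_1(A) =
0`. -/
lemma acyc_one_middle (h : IsSES i p) {n : FIm m} (hA : Acyc 1 A n) (hC : Acyc 1 C n) :
    Acyc 1 B n := by
  obtain ⟨P, KB, KC, _, b, q, c, i', p', hB', hC', hK, e1, e2⟩ := exists_kernel_sequence h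
  rw [acyc_one_iff hB']
  intro w hw
  refine mem_idealMul_of_acyc_one hK hA w ((acyc_one_iff hC' n).1 hC _ ?_)
  rw [← e1] at hw
  exact hw

/-- Exactness of `H_2(C) → H_1(A) → H_1(B)`, obtained by rotating to the sequence `KB → KC → A`. -/
lemma acyc_one_left (h : IsSES i p) {n : FIm m} (hC : Acyc 2 C n) (hB : Acyc 1 B n) :
    Acyc 1 A n := by
  obtain ⟨P, KB, KC, _, b, q, c, i', p', hB', hC', hK, e1, e2⟩ := exists_kernel_sequence h
  refine acyc_one_right hK ((acyc_succ_succ_iff hC' 0 n).1 hC) fun w hw => ?_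
  refine (acyc_one_iff hB' n).1 hB _ ?_
  rw [← e1]
  exact app_mem_idealMul c hw

/-- Passing to kernels rotates `A → B → C` into `KB → KC → A` and lowers by one the homological
degree for `B` and `C`. One rotation turns the first claim into the second one level down; the
second claim needs two rotations and the first claim. Hence both are proved together. -/
lemma acyc_two_out_of_three (s : ℕ) (n : FIm m) : ∀ {A B C : Mod m k} {i : A ⟶ B} {p : B ⟶ C},
    IsSES i p → (Acyc (s + 1) A n → Acyc (s + 1) C n → Acyc (s + 1) B n) ∧
      (Acyc (s + 2) C n → Acyc (s + 1) B n → Acyc (s + 1) A n) := by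
  induction s with
  | zero => exact fun h => ⟨acyc_one_middle h, acyc_one_left h⟩
  | succ s ih =>
    intro A B C i p h
    obtain ⟨P, KB, KC, _, b, q, c, i', p', hB', hC', hK, -, -⟩ := exists_kernel_sequence h
    rw [acyc_succ_succ_iff hB', acyc_succ_succ_iff hC', acyc_succ_succ_iff hC']
    refine ⟨(ih hK).2, fun hC hB => ?_⟩
    obtain ⟨P', KB', KC', _, b', q', c', i'', p'', hB'', hC'', hK', -, -⟩ :=
      exists_kernel_sequence hK
    exact (acyc_succ_succ_iff hC'' s n).2
      ((ih hK').1 ((acyc_succ_succ_iff hB'' s n).1 hC) hB)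

lemma acyc_right (h : IsSES i p) (s : ℕ) {n : FIm m} (hB : Acyc (s + 2) B n)
    (hA : Acyc (s + 1) A n) : Acyc (s + 2) C n := by
  obtain ⟨P, KB, KC, _, b, q, c, i', p', hB', hC', hK, -, -⟩ := exists_kernel_sequence h
  exact (acyc_succ_succ_iff hC' s n).2
    ((acyc_two_out_of_three s n hK).1 ((acyc_succ_succ_iff hB' s n).1 hB) hA)

end LongExact

lemma Acyc.of_iso {V W : Mod m k} (e : V ≅ W) {s : ℕ} {n : FIm m} (h : Acyc s V n) :
    Acyc s W n :=
  IsZero.of_iso h ((((quotFunctor m k).leftDerived s).mapIso e).app n).symm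

/-! ### Free covers and locality of homology -/

/-- The basis of the free cover of `V` at `t`. -/
abbrev CoverBasis (V : Mod m k) (t : FIm m) : Type u :=
  Σ (j : FIm m) (_ : {x : V.obj j // x ≠ 0}), (j ⟶ t)

/-- The free module on all nonzero elements of `V`. -/
def cover (V : Mod m k) : Mod m k where
  obj t := ModuleCat.of k (CoverBasis V t →₀ k)
  map g := ModuleCat.ofHom (Finsupp.lmapDomain k k (fun b => ⟨b.1, b.2.1, b.2.2 ≫ g⟩))
  map_id t := by
    ext b
    simp
  map_comp g h := by
    ext b
    simp

/-- The morphism from the free cover determined by images of the basis. -/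
def coverDesc {V W : Mod m k} (c : ∀ j, {x : V.obj j // x ≠ 0} → W.obj j) : cover V ⟶ W where
  app t := ModuleCat.ofHom
    (Finsupp.linearCombination k (fun b : CoverBasis V t => (W.map b.2.2).hom (c b.1 b.2.1)))
  naturality s t g := by
    apply ModuleCat.hom_ext
    refine Finsupp.lhom_ext' fun b => LinearMap.ext_ring ?_
    change Finsupp.linearCombination k _ (Finsupp.mapDomain _ (Finsupp.single b 1)) =
      (W.map g).hom (Finsupp.linearCombination k _ (Finsupp.single b 1))
    rw [Finsupp.mapDomain_single, Finsupp.linearCombination_single,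
      Finsupp.linearCombination_single, one_smul, one_smul, W.map_comp]
    rfl

lemma coverDesc_single {V W : Mod m k} (c : ∀ j, {x : V.obj j // x ≠ 0} → W.obj j)
    {t : FIm m} (b : CoverBasis V t) :
    ((coverDesc c).app t).hom (Finsupp.single b (1 : k)) = (W.map b.2.2).hom (c b.1 b.2.1) :=
  (Finsupp.linearCombination_single ..).trans (one_smul ..)

lemma cover_hom_ext {V W : Mod m k} {φ ψ : cover V ⟶ W}
    (h : ∀ (j : FIm m) (x : {x : V.obj j // x ≠ 0}),
      (φ.app j).hom (Finsupp.single ⟨j, x, 𝟙 j⟩ (1 : k)) =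
        (ψ.app j).hom (Finsupp.single ⟨j, x, 𝟙 j⟩ (1 : k))) : φ = ψ := by
  ext t : 2
  apply ModuleCat.hom_ext
  refine Finsupp.lhom_ext' fun ⟨j, x, f⟩ => LinearMap.ext_ring ?_
  have e : ((cover V).map f).hom (Finsupp.single ⟨j, x, 𝟙 j⟩ (1 : k)) =
      Finsupp.single (⟨j, x, f⟩ : CoverBasis V t) (1 : k) := by
    refine (Finsupp.mapDomain_single ..).trans ?_
    simp
  change (φ.app t).hom (Finsupp.single ⟨j, x, f⟩ (1 : k)) =
    (ψ.app t).hom (Finsupp.single ⟨j, x, f⟩ (1 : k))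
  rw [← e]
  exact (NatTrans.naturality_apply φ f _).trans ((congrArg _ (h j x)).trans
    (NatTrans.naturality_apply ψ f _).symm)

instance (V : Mod m k) : Projective (cover V) where
  factors {E X} f e _ := by
    choose c hc using fun (j : FIm m) (x : {x : V.obj j // x ≠ 0}) =>
      surjective_of_epi e j ((f.app j).hom (Finsupp.single ⟨j, x, 𝟙 j⟩ (1 : k)))
    refine ⟨coverDesc c, cover_hom_ext fun j x => ?_⟩
    rw [← hc]
    refine congrArg (e.app j).hom ((coverDesc_single c _).trans ?_)
    simp

/-- The canonical epimorphism from the free cover. -/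
def coverMap (V : Mod m k) : cover V ⟶ V := coverDesc fun _ x => x.1

lemma coverMap_surjective (V : Mod m k) (t : FIm m) :
    Function.Surjective ((coverMap V).app t).hom := by
  intro x
  by_cases hx : x = 0
  · exact ⟨0, by rw [map_zero, hx]⟩
  · refine ⟨_, (coverDesc_single _ ⟨t, ⟨x, hx⟩, 𝟙 t⟩).trans ?_⟩
    simp

/-- Indexing the cover by nonzero elements only makes its basis at `n` empty when `V` is zero below
`n`; this is what makes homology local. -/
lemma cover_eq_zero {V : Mod m k} {n : FIm m}
    (h : ∀ j : FIm m, j.size ≤ n.size → ∀ x : V.obj j, x = 0) (y : (cover V).obj n) : y = 0 := by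
  have : IsEmpty (CoverBasis V n) := ⟨fun b => b.2.1.2 (h b.1 (size_le_of_hom b.2.2) _)⟩
  exact Finsupp.ext fun b => isEmptyElim b

/-- The homology of `V` at `n` vanishes if `V` is zero at all `j ≤ n`. -/
lemma acyc_of_eq_zero (s : ℕ) : ∀ {V : Mod m k} {n : FIm m}
    (_ : ∀ j : FIm m, j.size ≤ n.size → ∀ x : V.obj j, x = 0), Acyc (s + 1) V n := by
  induction s with
  | zero =>
    intro V n h
    rw [acyc_one_iff (isSES_kerSub _ (coverMap_surjective V))]
    intro x _
    have : x = 0 := Subtype.ext (cover_eq_zero h x.1)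
    rw [this]
    exact Submodule.zero_mem _
  | succ s ih =>
    intro V n h
    rw [acyc_succ_succ_iff (isSES_kerSub _ (coverMap_surjective V))]
    exact ih fun j hj x => Subtype.ext (cover_eq_zero (fun i hi => h i (hi.trans hj)) x.1)

/-! ### Morphisms of the category -/

instance (n t : FIm m) : Finite (n ⟶ t) :=
  inferInstanceAs (Finite (∀ i, Fin (n.size i) ↪ Fin (t.size i)))

lemma comp_apply {n t r : FIm m} (f : n ⟶ t) (g : t ⟶ r) (i : Fin m) (a : Fin (n.size i)) :
    (f ≫ g) i a = g i (f i a) := rfl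

lemma hom_ext {n t : FIm m} {f g : n ⟶ t} (h : ∀ i a, f i a = g i a) : f = g :=
  funext fun i => DFunLike.ext _ _ (h i)

lemma comp_right_cancel {n t r : FIm m} {f g : n ⟶ t} {h : t ⟶ r} (e : f ≫ h = g ≫ h) : f = g :=
  hom_ext fun i a => (h i).injective (DFunLike.congr_fun (congrFun e i) a)

/-- Endomorphisms are invertible. -/
lemma exists_left_inverse {n : FIm m} (σ : n ⟶ n) : ∃ τ : n ⟶ n, τ ≫ σ = 𝟙 n := by
  have h : ∀ i, Function.Surjective (σ i) := fun i => Finite.surjective_of_injective (σ i).injective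
  choose g hg using h
  exact ⟨fun i => ⟨g i, Function.LeftInverse.injective (g := σ i) (hg i)⟩, hom_ext fun i a => hg i a⟩

lemma size_lt_of_hom {n t : FIm m} (f : n ⟶ t) (h : t ≠ n) : n.size < t.size :=
  lt_of_le_of_ne (size_le_of_hom f) fun e => h (FIm.ext e.symm)

/-! ### Basic relative projective modules -/

/-- The basis element of `M(n)_t` given by a morphism. -/
def freeMk {n t : FIm m} (f : n ⟶ t) : (free k n).obj t := Finsupp.single f (1 : k)

lemma map_freeMk {n t r : FIm m} (f : n ⟶ t) (g : t ⟶ r) :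
    ((free k n).map g).hom (freeMk f) = freeMk (f ≫ g) :=
  Finsupp.mapDomain_single ..

lemma freeRight_freeMk {n t : FIm m} (σ : n ⟶ n) (f : n ⟶ t) :
    freeRight k (σ : CategoryTheory.End n) t (freeMk f) = freeMk (σ ≫ f) :=
  Finsupp.mapDomain_single ..

lemma free_linear_ext {n t : FIm m} {M : Type*} [AddCommGroup M] [Module k M]
    {φ ψ : (free k n).obj t →ₗ[k] M} (h : ∀ f, φ (freeMk f) = ψ (freeMk f)) : φ = ψ :=
  Finsupp.lhom_ext' fun f => LinearMap.ext_ring (h f)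

/-- The linear map out of `M(n)_t` determined by a family. -/
def freeLin {n t : FIm m} {M : Type*} [AddCommGroup M] [Module k M] (c : (n ⟶ t) → M) :
    (free k n).obj t →ₗ[k] M :=
  Finsupp.linearCombination k c

lemma freeLin_freeMk {n t : FIm m} {M : Type*} [AddCommGroup M] [Module k M] (c : (n ⟶ t) → M)
    (f : n ⟶ t) : freeLin (k := k) c (freeMk f) = c f :=
  (Finsupp.linearCombination_single ..).trans (one_smul ..)

section Basic

variable {n : FIm m} {U : Type u} [AddCommGroup U] [Module k U]
  (ρ : Representation k (CategoryTheory.End n) U)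

/-- The projection onto `M(n)_t ⊗_{kS_n} U`. -/
def basicProj (t : FIm m) : (free k n).obj t ⊗[k] U →ₗ[k] (basic n ρ).obj t :=
  (basicRel n ρ t).mkQ

lemma basicProj_surjective (t : FIm m) : Function.Surjective (basicProj ρ t) :=
  Submodule.mkQ_surjective _

/-- The element `f ⊗ u` of `M(n) ⊗_{kS_n} U`. -/
def basicMk {t : FIm m} (f : n ⟶ t) : U →ₗ[k] (basic n ρ).obj t :=
  basicProj ρ t ∘ₗ TensorProduct.mk k ((free k n).obj t) U (freeMk f)

lemma basicMk_comp {t : FIm m} (σ : n ⟶ n) (f : n ⟶ t) (u : U) :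
    basicMk ρ (σ ≫ f) u = basicMk ρ f (ρ σ u) := by
  refine (Submodule.Quotient.eq _).2 (Submodule.subset_span ⟨freeMk f, σ, u, ?_⟩)
  rw [freeRight_freeMk]
  rfl

lemma map_basicMk {t r : FIm m} (g : t ⟶ r) (f : n ⟶ t) (u : U) :
    ((basic n ρ).map g).hom (basicMk ρ f u) = basicMk ρ (f ≫ g) u := by
  refine congrArg (Submodule.Quotient.mk (p := basicRel n ρ r)) ?_
  refine (LinearMap.rTensor_tmul ..).trans ?_
  rw [map_freeMk]
  rfl

variable {ρ} in
lemma basic_linear_ext {t : FIm m} {M : Type*} [AddCommGroup M] [Module k M]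
    {φ ψ : (basic n ρ).obj t →ₗ[k] M} (h : ∀ f u, φ (basicMk ρ f u) = ψ (basicMk ρ f u)) :
    φ = ψ := by
  have key : φ ∘ₗ basicProj ρ t = ψ ∘ₗ basicProj ρ t := TensorProduct.ext
    (free_linear_ext fun f => LinearMap.ext fun u => h f u)
  refine LinearMap.ext fun x => ?_
  obtain ⟨x, rfl⟩ := basicProj_surjective ρ t x
  exact LinearMap.congr_fun key x

variable {ρ} in
lemma span_basicMk (t : FIm m) :
    Submodule.span k {x : (basic n ρ).obj t | ∃ f u, basicMk ρ f u = x} = ⊤ := by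
  have : (Submodule.span k {x : (basic n ρ).obj t | ∃ f u, basicMk ρ f u = x}).mkQ = 0 :=
    basic_linear_ext fun f u =>
      (Submodule.Quotient.mk_eq_zero _).2 (Submodule.subset_span ⟨f, u, rfl⟩)
  rw [← Submodule.ker_mkQ (Submodule.span k _), this, LinearMap.ker_zero]

variable {ρ} in
lemma basic_induction {t : FIm m} {p : (basic n ρ).obj t → Prop} (x : (basic n ρ).obj t)
    (h0 : p 0) (hadd : ∀ x y, p x → p y → p (x + y)) (h : ∀ f u, p (basicMk ρ f u)) : p x := by
  have hx : x ∈ Submodule.span k {x : (basic n ρ).obj t | ∃ f u, basicMk ρ f u = x} := by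
    rw [span_basicMk]
    trivial
  refine Submodule.closure_induction (p := fun x _ => p x) h0 (fun x y _ _ => hadd x y) ?_ hx
  rintro r _ ⟨f, u, rfl⟩
  rw [← map_smul]
  exact h f _

/-- The linear map out of `M(n)_t ⊗_{kS_n} U` determined by a balanced family. -/
def basicLift {t : FIm m} {M : Type*} [AddCommGroup M] [Module k M]
    (φ : (n ⟶ t) → U →ₗ[k] M) (hφ : ∀ (σ : n ⟶ n) f u, φ (σ ≫ f) u = φ f (ρ σ u)) :
    (basic n ρ).obj t →ₗ[k] M :=
  (basicRel n ρ t).liftQ (TensorProduct.lift (freeLin φ)) (by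
    refine Submodule.span_le.2 ?_
    rintro _ ⟨p, σ, u, rfl⟩
    rw [SetLike.mem_coe, LinearMap.mem_ker, map_sub, sub_eq_zero, TensorProduct.lift.tmul,
      TensorProduct.lift.tmul]
    have key : (freeLin φ).flip u ∘ₗ freeRight k σ t = (freeLin φ).flip (ρ σ u) :=
      free_linear_ext fun f => by
        rw [LinearMap.comp_apply, freeRight_freeMk, LinearMap.flip_apply, LinearMap.flip_apply,
          freeLin_freeMk, freeLin_freeMk]
        exact hφ σ f u
    exact LinearMap.congr_fun key p)

lemma basicLift_basicMk {t : FIm m} {M : Type*} [AddCommGroup M] [Module k M]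
    (φ : (n ⟶ t) → U →ₗ[k] M) (hφ : ∀ (σ : n ⟶ n) f u, φ (σ ≫ f) u = φ f (ρ σ u))
    (f : n ⟶ t) (u : U) : basicLift ρ φ hφ (basicMk ρ f u) = φ f u := by
  refine (TensorProduct.lift.tmul ..).trans ?_
  rw [freeLin_freeMk]

lemma basicDesc_balanced {V : Mod m k} (φ : U →ₗ[k] V.obj n)
    (hφ : ∀ (σ : n ⟶ n) u, φ (ρ σ u) = (V.map σ).hom (φ u)) {t : FIm m} (σ : n ⟶ n) (f : n ⟶ t)
    (u : U) : ((V.map (σ ≫ f)).hom ∘ₗ φ) u = ((V.map f).hom ∘ₗ φ) (ρ σ u) := by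
  simp [hφ]

/-- The morphism `M(n) ⊗_{kS_n} U → V` determined by an equivariant map `U → V_n`. -/
def basicDesc {V : Mod m k} (φ : U →ₗ[k] V.obj n)
    (hφ : ∀ (σ : n ⟶ n) u, φ (ρ σ u) = (V.map σ).hom (φ u)) : basic n ρ ⟶ V where
  app t := ModuleCat.ofHom (basicLift ρ (fun f => (V.map f).hom ∘ₗ φ)
    (basicDesc_balanced ρ φ hφ))
  naturality t r g := by
    apply ModuleCat.hom_ext
    refine basic_linear_ext fun f u => ?_
    change basicLift ρ (fun f => (V.map f).hom ∘ₗ φ) (basicDesc_balanced ρ φ hφ)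
      (((basic n ρ).map g).hom (basicMk ρ f u)) =
      (V.map g).hom (basicLift ρ (fun f => (V.map f).hom ∘ₗ φ) (basicDesc_balanced ρ φ hφ)
      (basicMk ρ f u))
    rw [map_basicMk, basicLift_basicMk, basicLift_basicMk]
    simp

lemma basicDesc_basicMk {V : Mod m k} (φ : U →ₗ[k] V.obj n)
    (hφ : ∀ (σ : n ⟶ n) u, φ (ρ σ u) = (V.map σ).hom (φ u)) {t : FIm m} (f : n ⟶ t) (u : U) :
    ((basicDesc ρ φ hφ).app t).hom (basicMk ρ f u) = (V.map f).hom (φ u) :=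
  basicLift_basicMk ρ (fun f => (V.map f).hom ∘ₗ φ) (basicDesc_balanced ρ φ hφ) f u

variable {ρ} in
lemma basic_hom_ext {V : Mod m k} {φ ψ : basic n ρ ⟶ V}
    (h : ∀ u, (φ.app n).hom (basicMk ρ (𝟙 n) u) = (ψ.app n).hom (basicMk ρ (𝟙 n) u)) : φ = ψ := by
  ext t : 2
  apply ModuleCat.hom_ext
  refine basic_linear_ext fun f u => ?_
  have e : basicMk ρ f u = ((basic n ρ).map f).hom (basicMk ρ (𝟙 n) u) := by
    rw [map_basicMk, Category.id_comp]
  rw [e]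
  exact (NatTrans.naturality_apply φ f _).trans ((congrArg _ (h u)).trans
    (NatTrans.naturality_apply ψ f _).symm)

/-! ### Orbit decomposition of basic modules -/

lemma rho_comp (σ τ : n ⟶ n) (u : U) : ρ (σ ≫ τ) u = ρ τ (ρ σ u) :=
  LinearMap.congr_fun (MonoidHom.map_mul ρ τ σ) u

open Classical in
/-- The coordinate of `M(n)_t ⊗_{kS_n} U` at the orbit of `f`. -/
def basicCoord {t : FIm m} (f : n ⟶ t) : (basic n ρ).obj t →ₗ[k] U :=
  basicLift ρ (fun g => if h : ∃ σ : n ⟶ n, σ ≫ f = g then ρ h.choose else 0) (by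
    intro σ g u
    by_cases h : ∃ τ : n ⟶ n, τ ≫ f = g
    · have h' : ∃ τ : n ⟶ n, τ ≫ f = σ ≫ g := by
        obtain ⟨τ, rfl⟩ := h
        exact ⟨σ ≫ τ, Category.assoc ..⟩
      rw [dif_pos h, dif_pos h']
      -- Morphisms are monic, so the automorphism carrying `f` to a given morphism is unique and the
      -- choice is compatible with composition.
      have e : h'.choose = σ ≫ h.choose := comp_right_cancel (h := f) (by
        rw [h'.choose_spec, Category.assoc, h.choose_spec])
      exact (congrArg (fun τ => ρ τ u) e).trans (rho_comp ρ _ _ u)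
    · have h' : ¬ ∃ τ : n ⟶ n, τ ≫ f = σ ≫ g := by
        rintro ⟨τ, hτ⟩
        obtain ⟨σ', hσ⟩ := exists_left_inverse σ
        exact h ⟨σ' ≫ τ, by rw [Category.assoc, hτ, ← Category.assoc, hσ, Category.id_comp]⟩
      rw [dif_neg h, dif_neg h']
      rfl)

lemma basicCoord_comp {t : FIm m} (f : n ⟶ t) (σ : n ⟶ n) (u : U) :
    basicCoord ρ f (basicMk ρ (σ ≫ f) u) = ρ σ u := by
  have h : ∃ τ : n ⟶ n, τ ≫ f = σ ≫ f := ⟨σ, rfl⟩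
  refine (basicLift_basicMk ..).trans ?_
  rw [dif_pos h]
  exact congrArg (fun τ => ρ τ u) (comp_right_cancel h.choose_spec)

lemma basicCoord_self {t : FIm m} (f : n ⟶ t) (u : U) :
    basicCoord ρ f (basicMk ρ f u) = u := by
  have := basicCoord_comp ρ f (𝟙 n) u
  rw [Category.id_comp] at this
  exact this.trans (DFunLike.congr_fun (map_one ρ) u)

lemma basicCoord_of_not_exists {t : FIm m} (f g : n ⟶ t) (h : ¬ ∃ σ : n ⟶ n, σ ≫ f = g) (u : U) :
    basicCoord ρ f (basicMk ρ g u) = 0 := by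
  refine (basicLift_basicMk ..).trans ?_
  rw [dif_neg h]
  rfl

/-- Morphisms with the same orbit under precomposition with automorphisms. -/
def orbitSetoid (n t : FIm m) : Setoid (n ⟶ t) where
  r f g := ∃ σ : n ⟶ n, σ ≫ f = g
  iseqv :=
    { refl := fun f => ⟨𝟙 n, Category.id_comp f⟩
      symm := by
        rintro f _ ⟨σ, rfl⟩
        obtain ⟨τ, hτ⟩ := exists_left_inverse σ
        exact ⟨τ, by rw [← Category.assoc, hτ, Category.id_comp]⟩
      trans := by
        rintro f _ _ ⟨σ, rfl⟩ ⟨τ, rfl⟩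
        exact ⟨τ ≫ σ, Category.assoc ..⟩ }

instance (n t : FIm m) : Fintype (Quotient (orbitSetoid n t)) := Fintype.ofFinite _

/-- The action of `End n` on morphisms `n ⟶ t` is free, so the value at `t` is a direct sum of
copies of `U`, one for each orbit. -/
lemma sum_basicMk_basicCoord {t : FIm m} (x : (basic n ρ).obj t) :
    ∑ q : Quotient (orbitSetoid n t), basicMk ρ q.out (basicCoord ρ q.out x) = x := by
  refine basic_induction (p := fun x => ∑ q : Quotient (orbitSetoid n t),
    basicMk ρ q.out (basicCoord ρ q.out x) = x) x (by simp) (fun x y hx hy => ?_) (fun f u => ?_)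
  · simp only [map_add, Finset.sum_add_distrib, hx, hy]
  · rw [Finset.sum_eq_single (Quotient.mk (orbitSetoid n t) f)]
    · obtain ⟨σ, hσ⟩ := Quotient.exact (s := orbitSetoid n t)
        (Quotient.out_eq (Quotient.mk (orbitSetoid n t) f))
      nth_rewrite 3 [← hσ]
      rw [basicCoord_comp, ← basicMk_comp, hσ]
    · intro q _ hq
      rw [basicCoord_of_not_exists, map_zero]
      rintro ⟨σ, hσ⟩
      refine hq ((Quotient.out_eq q).symm.trans (Quotient.sound (s := orbitSetoid n t) ⟨σ, hσ⟩))
    · simp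

lemma basic_eq_zero {t : FIm m} (x : (basic n ρ).obj t) (h : ∀ f, basicCoord ρ f x = 0) :
    x = 0 := by
  rw [← sum_basicMk_basicCoord ρ x]
  simp [h]

lemma basicMk_id_surjective : Function.Surjective (basicMk ρ (𝟙 n)) := by
  intro x
  refine basic_induction (p := fun x => ∃ u, basicMk ρ (𝟙 n) u = x) x ⟨0, map_zero _⟩ ?_ fun f u => ⟨ρ f u, ?_⟩
  · rintro _ _ ⟨a, rfl⟩ ⟨b, rfl⟩
    exact ⟨a + b, map_add _ _ _⟩
  · rw [← basicMk_comp, Category.comp_id]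

lemma basic_eq_zero_of_isEmpty {t : FIm m} (h : ¬ n.size ≤ t.size) (x : (basic n ρ).obj t) :
    x = 0 :=
  basic_eq_zero ρ x fun f => absurd (size_le_of_hom f) h

/-- Each `f ⊗ u` is the image of `𝟙 ⊗ u` under `f`, which strictly raises the object. With
`eq_zero_of_mem_idealMul_basic`, `H_0` of a basic module is concentrated at `n`. -/
lemma idealMul_basic_of_ne {t : FIm m} (h : t ≠ n) : idealMul (basic n ρ) t = ⊤ := by
  refine Submodule.eq_top_iff'.2 fun x => ?_
  refine basic_induction x (Submodule.zero_mem _) (fun x y => Submodule.add_mem _) fun f u => ?_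
  have := map_mem_idealMul (size_lt_of_hom f h) f (basicMk ρ (𝟙 n) u)
  rwa [map_basicMk, Category.id_comp] at this

lemma eq_zero_of_mem_idealMul_basic {x : (basic n ρ).obj n} (hx : x ∈ idealMul (basic n ρ) n) :
    x = 0 := by
  refine idealMul_induction (p := fun x => x = 0) hx rfl ?_ ?_
  · rintro _ _ rfl rfl
    exact add_zero 0
  · intro j hj f y
    rw [basic_eq_zero_of_isEmpty ρ (not_le_of_gt hj) y, map_zero]

end Basic

/-! ### Acyclicity of basic relative projective modules -/

/-- The representation of `End n` on the value of a module at `n`. -/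
def endRep (V : Mod m k) (n : FIm m) : Representation k (CategoryTheory.End n) (V.obj n) where
  toFun σ := (V.map (σ : n ⟶ n)).hom
  map_one' := by
    change (V.map (𝟙 n)).hom = _
    rw [V.map_id]
    rfl
  map_mul' σ τ := by
    change (V.map ((τ : n ⟶ n) ≫ (σ : n ⟶ n))).hom = _
    rw [V.map_comp]
    rfl

section BasicMap

variable {n : FIm m} {U U' U'' : Type u} [AddCommGroup U] [Module k U] [AddCommGroup U']
  [Module k U'] [AddCommGroup U''] [Module k U'']
  (ρ : Representation k (CategoryTheory.End n) U)
  (ρ' : Representation k (CategoryTheory.End n) U')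
  (ρ'' : Representation k (CategoryTheory.End n) U'')

/-- The morphism of basic modules induced by an equivariant map. -/
def basicMap (φ : U →ₗ[k] U') (hφ : ∀ (σ : n ⟶ n) u, φ (ρ σ u) = ρ' σ (φ u)) :
    basic n ρ ⟶ basic n ρ' :=
  basicDesc ρ (basicMk ρ' (𝟙 n) ∘ₗ φ) fun σ u => by
    rw [LinearMap.comp_apply, LinearMap.comp_apply, hφ, map_basicMk, ← basicMk_comp,
      Category.comp_id, Category.id_comp]

variable {ρ ρ' ρ''}

lemma basicMap_basicMk {φ : U →ₗ[k] U'} (hφ : ∀ (σ : n ⟶ n) u, φ (ρ σ u) = ρ' σ (φ u))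
    {t : FIm m} (f : n ⟶ t) (u : U) :
    ((basicMap ρ ρ' φ hφ).app t).hom (basicMk ρ f u) = basicMk ρ' f (φ u) := by
  refine (basicDesc_basicMk ..).trans ?_
  rw [LinearMap.comp_apply, map_basicMk, Category.id_comp]

lemma basicCoord_basicMap {φ : U →ₗ[k] U'} (hφ : ∀ (σ : n ⟶ n) u, φ (ρ σ u) = ρ' σ (φ u))
    {t : FIm m} (f : n ⟶ t) (x : (basic n ρ).obj t) :
    basicCoord ρ' f (((basicMap ρ ρ' φ hφ).app t).hom x) = φ (basicCoord ρ f x) := by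
  have key : basicCoord ρ' f ∘ₗ ((basicMap ρ ρ' φ hφ).app t).hom = φ ∘ₗ basicCoord ρ f :=
    basic_linear_ext fun g u => by
      rw [LinearMap.comp_apply, LinearMap.comp_apply, basicMap_basicMk]
      by_cases h : ∃ σ : n ⟶ n, σ ≫ f = g
      · obtain ⟨σ, rfl⟩ := h
        rw [basicCoord_comp, basicCoord_comp, hφ]
      · rw [basicCoord_of_not_exists ρ _ _ h, basicCoord_of_not_exists ρ' _ _ h, map_zero]
  exact LinearMap.congr_fun key x

/-- Exactness is checked in orbit coordinates, where the induced map is just the given map of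
representations. -/
lemma isSES_basicMap {φ : U →ₗ[k] U'} (hφ : ∀ (σ : n ⟶ n) u, φ (ρ σ u) = ρ' σ (φ u))
    {ψ : U' →ₗ[k] U''} (hψ : ∀ (σ : n ⟶ n) u, ψ (ρ' σ u) = ρ'' σ (ψ u))
    (hinj : Function.Injective φ) (hsurj : Function.Surjective ψ) (hex : Function.Exact φ ψ) :
    IsSES (basicMap ρ ρ' φ hφ) (basicMap ρ' ρ'' ψ hψ) where
  inj t := by
    rw [injective_iff_map_eq_zero]
    intro x hx
    refine basic_eq_zero ρ x fun f => hinj ?_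
    rw [← basicCoord_basicMap hφ, hx, map_zero, map_zero]
  surj t x := by
    refine basic_induction (p := fun x => ∃ y, ((basicMap ρ' ρ'' ψ hψ).app t).hom y = x) x
      ⟨0, map_zero _⟩ ?_ ?_
    · rintro _ _ ⟨a, rfl⟩ ⟨b, rfl⟩
      exact ⟨a + b, map_add _ _ _⟩
    · intro f u
      obtain ⟨u, rfl⟩ := hsurj u
      exact ⟨_, basicMap_basicMk hψ f u⟩
  exact t x := by
    constructor
    · intro hx
      have h : ∀ f : n ⟶ t, ∃ w, φ w = basicCoord ρ' f x := fun f => (hex _).1 (by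
        rw [← basicCoord_basicMap hψ, hx, map_zero])
      choose w hw using h
      refine ⟨∑ q : Quotient (orbitSetoid n t), basicMk ρ q.out (w q.out), ?_⟩
      rw [map_sum]
      refine Eq.trans ?_ (sum_basicMk_basicCoord ρ' x)
      exact Finset.sum_congr rfl fun q _ => by rw [basicMap_basicMk, hw]
    · rintro ⟨y, rfl⟩
      refine basic_eq_zero ρ'' _ fun f => ?_
      rw [basicCoord_basicMap hψ, basicCoord_basicMap hφ]
      exact hex.apply_apply_eq_zero _

end BasicMap

lemma basicMk_id_rho {n : FIm m} {U : Type u} [AddCommGroup U] [Module k U]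
    (ρ : Representation k (CategoryTheory.End n) U) (σ : n ⟶ n) (u : U) :
    basicMk ρ (𝟙 n) (ρ σ u) = ((basic n ρ).map σ).hom (basicMk ρ (𝟙 n) u) := by
  rw [map_basicMk, ← basicMk_comp, Category.comp_id, Category.id_comp]

lemma free_single_eq {n : FIm m} {α : Type u} (a : α) (σ : CategoryTheory.End n) :
    (Finsupp.single a (MonoidAlgebra.single σ 1) : α →₀ MonoidAlgebra k (CategoryTheory.End n)) =
      Representation.free k (CategoryTheory.End n) α σ
        (Finsupp.single a (MonoidAlgebra.single 1 1)) := by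
  rw [Representation.free_single_single, mul_one]

/-- A morphism out of this module amounts to a free choice of images at `n` for the generators in
`α`, and such images lift along epimorphisms. -/
instance (n : FIm m) (α : Type u) :
    Projective (basic n (Representation.free k (CategoryTheory.End n) α)) where
  factors {E X} f e _ := by
    let F := Representation.free k (CategoryTheory.End n) α
    choose c hc using fun a : α => surjective_of_epi e n
      ((f.app n).hom (basicMk F (𝟙 n) (Finsupp.single a (MonoidAlgebra.single 1 1))))
    let φ := Representation.freeLift (endRep E n) c
    have hφ : ∀ (σ : n ⟶ n) u, φ.toLinearMap (F σ u) = (E.map σ).hom (φ.toLinearMap u) :=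
      fun σ u => Representation.IntertwiningMap.isIntertwining _ _ φ σ u
    have key : (e.app n).hom ∘ₗ φ.toLinearMap = (f.app n).hom ∘ₗ basicMk F (𝟙 n) := by
      refine Finsupp.lhom_ext' fun a => MonoidAlgebra.lhom_ext' fun σ => LinearMap.ext_ring ?_
      change (e.app n).hom (φ.toLinearMap (Finsupp.single a (MonoidAlgebra.single σ 1))) =
        (f.app n).hom (basicMk F (𝟙 n) (Finsupp.single a (MonoidAlgebra.single σ 1)))
      have h1 : φ.toLinearMap (Finsupp.single a (MonoidAlgebra.single 1 1)) = c a := by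
        refine (Representation.freeLift_single_single ..).trans ?_
        rw [one_smul, map_one]
        rfl
      rw [free_single_eq, hφ, h1, basicMk_id_rho]
      exact (NatTrans.naturality_apply e σ (c a)).trans ((congrArg _ (hc a)).trans
        (NatTrans.naturality_apply f σ _).symm)
    exact ⟨basicDesc F φ.toLinearMap hφ, basic_hom_ext fun u => by
      refine (congrArg (e.app n).hom (basicDesc_basicMk ..)).trans ?_
      rw [E.map_id]
      exact LinearMap.congr_fun key u⟩

/-- The kernel of an equivariant map, as a representation. -/
def kerRep {n : FIm m} {F U : Type u} [AddCommGroup F] [Module k F] [AddCommGroup U] [Module k U]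
    (ρF : Representation k (CategoryTheory.End n) F) (ρ : Representation k (CategoryTheory.End n) U)
    (q : F →ₗ[k] U) (hq : ∀ (σ : n ⟶ n) u, q (ρF σ u) = ρ σ (q u)) :
    Representation k (CategoryTheory.End n) (LinearMap.ker q) where
  toFun σ := (ρF σ).restrict fun x hx => by
    rw [LinearMap.mem_ker] at hx ⊢
    rw [hq, hx, map_zero]
  map_one' := LinearMap.ext fun x => Subtype.ext (LinearMap.congr_fun (map_one ρF) x.1)
  map_mul' σ τ := LinearMap.ext fun x => Subtype.ext (LinearMap.congr_fun (map_mul ρF σ τ) x.1)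

lemma isSES_kerRep {n : FIm m} {F U : Type u} [AddCommGroup F] [Module k F] [AddCommGroup U]
    [Module k U] (ρF : Representation k (CategoryTheory.End n) F)
    (ρ : Representation k (CategoryTheory.End n) U) (q : F →ₗ[k] U)
    (hq : ∀ (σ : n ⟶ n) u, q (ρF σ u) = ρ σ (q u)) (hsurj : Function.Surjective q) :
    IsSES (basicMap (kerRep ρF ρ q hq) ρF (LinearMap.ker q).subtype fun _ _ => rfl)
      (basicMap ρF ρ q hq) :=
  isSES_basicMap _ _ Subtype.val_injective hsurj (LinearMap.exact_subtype_ker_map _)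

/-- The equivariant map from the free representation on a representation. -/
def freeCover {n : FIm m} {U : Type u} [AddCommGroup U] [Module k U]
    (ρ : Representation k (CategoryTheory.End n) U) :
    (U →₀ MonoidAlgebra k (CategoryTheory.End n)) →ₗ[k] U :=
  (Representation.freeLift ρ (id : U → U)).toLinearMap

lemma freeCover_rho {n : FIm m} {U : Type u} [AddCommGroup U] [Module k U]
    (ρ : Representation k (CategoryTheory.End n) U) (σ : n ⟶ n)
    (u : U →₀ MonoidAlgebra k (CategoryTheory.End n)) :
    freeCover ρ (Representation.free k (CategoryTheory.End n) U σ u) = ρ σ (freeCover ρ u) :=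
  Representation.IntertwiningMap.isIntertwining (Representation.free k (CategoryTheory.End n) U) ρ
    (Representation.freeLift ρ (id : U → U)) σ u

lemma freeCover_surjective {n : FIm m} {U : Type u} [AddCommGroup U] [Module k U]
    (ρ : Representation k (CategoryTheory.End n) U) : Function.Surjective (freeCover ρ) := fun u =>
  ⟨Finsupp.single u (MonoidAlgebra.single 1 1), by
    refine (Representation.freeLift_single_single ..).trans ?_
    rw [one_smul, map_one]
    rfl⟩

/-- Basic relative projective modules are acyclic. -/
lemma acyc_basic (s : ℕ) (n j : FIm m) : ∀ {U : Type u} [AddCommGroup U] [Module k U]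
    (ρ : Representation k (CategoryTheory.End n) U), Acyc (s + 1) (basic n ρ) j := by
  induction s with
  | zero =>
    intro U _ _ ρ
    have h := isSES_kerRep (Representation.free k (CategoryTheory.End n) U) ρ (freeCover ρ)
      (freeCover_rho ρ) (freeCover_surjective ρ)
    rw [acyc_one_iff h]
    intro x hx
    -- At `n` the `𝔪`-part of the projective cover is zero; elsewhere `𝔪` times the kernel, again a
    -- basic module, is everything.
    by_cases hj : j = n
    · subst hj
      have h0 := eq_zero_of_mem_idealMul_basic _ hx
      rw [h.inj j (Eq.trans h0 (map_zero _).symm)]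
      exact Submodule.zero_mem _
    · rw [idealMul_basic_of_ne _ hj]
      trivial
  | succ s ih =>
    intro U _ _ ρ
    have h := isSES_kerRep (Representation.free k (CategoryTheory.End n) U) ρ (freeCover ρ)
      (freeCover_rho ρ) (freeCover_surjective ρ)
    exact (acyc_succ_succ_iff h s j).2 (ih _)

/-! ### Submodules generated in prescribed degrees -/

/-- The inclusion between two submodules. -/
def SubMod.incl {V : Mod m k} {N N' : SubMod V} (h : ∀ t, N.carrier t ≤ N'.carrier t) :
    N.toMod ⟶ N'.toMod where
  app t := ModuleCat.ofHom (Submodule.inclusion (h t))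
  naturality s t f := by
    ext x
    rfl

/-- The submodule `N ∩ N'` of `N'`. -/
def SubMod.relative {V : Mod m k} (N N' : SubMod V) : SubMod N'.toMod where
  carrier t := (N.carrier t).comap (N'.carrier t).subtype
  map_mem f x hx := N.map_mem f x.1 hx

lemma SubMod.isSES_incl {V : Mod m k} {N N' : SubMod V} (h : ∀ t, N.carrier t ≤ N'.carrier t) :
    IsSES (SubMod.incl h) (N.relative N').π where
  inj t := Submodule.inclusion_injective (h t)
  surj t := Submodule.mkQ_surjective _
  exact t x := by
    constructor
    · intro hx
      exact ⟨⟨x.1, (Submodule.Quotient.mk_eq_zero ((N.relative N').carrier t)).1 hx⟩, rfl⟩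
    · rintro ⟨y, rfl⟩
      exact (Submodule.Quotient.mk_eq_zero _).2 y.2

/-- A set of objects which is closed under passing to smaller objects. -/
def Down (S : Set (FIm m)) : Prop := ∀ ⦃i j : FIm m⦄, i.size ≤ j.size → j ∈ S → i ∈ S

/-- The submodule of `V` generated by its values at the objects of `S`. -/
def gen (V : Mod m k) (S : Set (FIm m)) : SubMod V where
  carrier t := ⨆ (j : FIm m) (_ : j ∈ S) (f : j ⟶ t), LinearMap.range (V.map f).hom
  map_mem {s t} g x hx := by
    suffices h : _ ≤ Submodule.comap (V.map g).hom
        (⨆ (j : FIm m) (_ : j ∈ S) (f : j ⟶ t), LinearMap.range (V.map f).hom) from h hx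
    refine iSup_le fun j => iSup_le fun hj => iSup_le fun f => ?_
    rintro _ ⟨x, rfl⟩
    refine Submodule.mem_iSup_of_mem j (Submodule.mem_iSup_of_mem hj
      (Submodule.mem_iSup_of_mem (f ≫ g) ⟨x, ?_⟩))
    simp

lemma map_mem_gen {V : Mod m k} {S : Set (FIm m)} {j t : FIm m} (hj : j ∈ S) (f : j ⟶ t)
    (x : V.obj j) : (V.map f).hom x ∈ (gen V S).carrier t :=
  Submodule.mem_iSup_of_mem j (Submodule.mem_iSup_of_mem hj
    (Submodule.mem_iSup_of_mem f ⟨x, rfl⟩))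

lemma mem_gen {V : Mod m k} {S : Set (FIm m)} {j : FIm m} (hj : j ∈ S) (x : V.obj j) :
    x ∈ (gen V S).carrier j := by
  have := map_mem_gen hj (𝟙 j) x
  rwa [V.map_id] at this

lemma gen_induction {V : Mod m k} {S : Set (FIm m)} {n : FIm m} {p : V.obj n → Prop} {x : V.obj n}
    (hx : x ∈ (gen V S).carrier n) (h0 : p 0) (hadd : ∀ x y, p x → p y → p (x + y))
    (h : ∀ (j : FIm m) (_ : j ∈ S) (f : j ⟶ n) (y : V.obj j), p ((V.map f).hom y)) : p x := by
  have key : ∀ x ∈ (gen V S).carrier n, p x := by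
    intro x hx
    refine Submodule.iSup_induction _ (motive := p) hx (fun j x hx => ?_) h0 hadd
    refine Submodule.iSup_induction _ (motive := p) hx (fun hj x hx => ?_) h0 hadd
    refine Submodule.iSup_induction _ (motive := p) hx (fun f x hx => ?_) h0 hadd
    obtain ⟨y, rfl⟩ := hx
    exact h j hj f y
  exact key x hx

lemma gen_mono (V : Mod m k) {S T : Set (FIm m)} (h : S ⊆ T) (t : FIm m) :
    (gen V S).carrier t ≤ (gen V T).carrier t := by
  intro x hx
  refine gen_induction (p := fun x => x ∈ (gen V T).carrier t) hx (Submodule.zero_mem _)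
    (fun x y => Submodule.add_mem _) fun j hj f y => map_mem_gen (h hj) f y

lemma deg_lt_of_size_lt {i j : FIm m} (h : i.size < j.size) : i.deg < j.deg := by
  obtain ⟨h1, a, h2⟩ := Pi.lt_def.1 h
  exact Finset.sum_lt_sum (fun b _ => h1 b) ⟨a, Finset.mem_univ _, h2⟩

/-- Nakayama's lemma on a downward closed set. -/
lemma eq_zero_of_idealMul {K : Mod m k} {L : Set (FIm m)} (hL : Down L)
    (h : ∀ j ∈ L, ∀ x : K.obj j, (∀ i : FIm m, i.size < j.size → ∀ y : K.obj i, y = 0) →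
      x = 0 ∨ x ∈ idealMul K j) : ∀ j ∈ L, ∀ x : K.obj j, x = 0 := by
  intro j
  induction hd : j.deg using Nat.strong_induction_on generalizing j with
  | _ d ih =>
    subst hd
    intro hj x
    have hlt : ∀ i : FIm m, i.size < j.size → ∀ y : K.obj i, y = 0 := fun i hi =>
      ih _ (deg_lt_of_size_lt hi) i rfl (hL hi.le hj)
    rcases h j hj x hlt with hx | hx
    · exact hx
    · refine idealMul_induction (p := fun x => x = 0) hx rfl ?_ ?_
      · rintro _ _ rfl rfl
        exact add_zero 0
      · intro i hi f y
        rw [hlt i hi y, map_zero]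

/-- The canonical morphism `M(n) ⊗_{kS_n} V_n → V`. -/
def counit (V : Mod m k) (n : FIm m) : basic n (endRep V n) ⟶ V :=
  basicDesc (endRep V n) LinearMap.id fun _ _ => rfl

lemma counit_basicMk (V : Mod m k) {n t : FIm m} (f : n ⟶ t) (x : V.obj n) :
    ((counit V n).app t).hom (basicMk (endRep V n) f x) = (V.map f).hom x :=
  basicDesc_basicMk ..

lemma counit_injective_self (V : Mod m k) (n : FIm m) :
    Function.Injective ((counit V n).app n).hom := by
  rw [injective_iff_map_eq_zero]
  intro x hx
  obtain ⟨u, rfl⟩ := basicMk_id_surjective _ x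
  rw [counit_basicMk, V.map_id] at hx
  have : u = 0 := hx
  rw [this, map_zero]

/-! ### Peeling off one generating object -/

section Peel

variable (V : Mod m k) (S : Set (FIm m)) (n : FIm m)

/-- The quotient of the submodule generated in `S ∪ {n}` by the submodule generated in `S`. -/
abbrev layer : Mod m k := ((gen V S).relative (gen V (insert n S))).quotient

lemma isSES_layer : IsSES (SubMod.incl (gen_mono V (Set.subset_insert n S)))
    ((gen V S).relative (gen V (insert n S))).π :=
  SubMod.isSES_incl _

variable {V S n}

/-- Generators coming from `S` die in the quotient, so the layer is generated by its value at `n`.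
-/
lemma layer_counit_surjective (t : FIm m) :
    Function.Surjective ((counit (layer V S n) n).app t).hom := by
  intro y
  obtain ⟨⟨x, hx⟩, rfl⟩ := (isSES_layer V S n).surj t y
  have key : ∃ (hx : x ∈ (gen V (insert n S)).carrier t) (b : _),
      ((counit (layer V S n) n).app t).hom b =
        (((gen V S).relative (gen V (insert n S))).π.app t).hom ⟨x, hx⟩ := by
    refine gen_induction (p := fun x => ∃ (hx : x ∈ (gen V (insert n S)).carrier t) (b : _),
      ((counit (layer V S n) n).app t).hom b =
        (((gen V S).relative (gen V (insert n S))).π.app t).hom ⟨x, hx⟩) hx ?_ ?_ ?_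
    · exact ⟨Submodule.zero_mem _, 0, (map_zero _).trans (map_zero _).symm⟩
    · rintro x y ⟨hx, b, hb⟩ ⟨hy, c, hc⟩
      exact ⟨Submodule.add_mem _ hx hy, b + c, by rw [map_add, hb, hc]; rfl⟩
    · intro j hj f y
      refine ⟨map_mem_gen hj f y, ?_⟩
      rcases hj with rfl | hj
      · exact ⟨basicMk _ f ((((gen V S).relative (gen V (insert j S))).π.app j).hom
          ⟨y, mem_gen (Set.mem_insert _ _) y⟩), counit_basicMk _ _ _⟩
      · refine ⟨0, (map_zero _).trans (Eq.symm ?_)⟩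
        exact (Submodule.Quotient.mk_eq_zero _).2 (map_mem_gen hj f y)
  exact key.choose_spec

/-- Injectivity of `H_0` of the smaller generated submodule into `H_0` of the larger. For `j ∈ S`
both submodules equal `V` at all objects below `j`, so their `𝔪`-parts at `j` agree; for `j ∉ S`
every element of the smaller one comes from a strictly smaller object. -/
lemma mem_idealMul_gen (hS : Down S) {j : FIm m}
    (a : (gen V S).toMod.obj j)
    (ha : ((SubMod.incl (gen_mono V (Set.subset_insert n S))).app j).hom a ∈
      idealMul (gen V (insert n S)).toMod j) : a ∈ idealMul (gen V S).toMod j := by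
  by_cases hj : j ∈ S
  · have key : ∃ a' ∈ idealMul (gen V S).toMod j,
        ((SubMod.incl (gen_mono V (Set.subset_insert n S))).app j).hom a' =
        ((SubMod.incl (gen_mono V (Set.subset_insert n S))).app j).hom a := by
      refine idealMul_induction (p := fun b => ∃ a' ∈ idealMul (gen V S).toMod j,
        ((SubMod.incl (gen_mono V (Set.subset_insert n S))).app j).hom a' = b) ha
        ⟨0, Submodule.zero_mem _, map_zero _⟩ ?_ ?_
      · rintro _ _ ⟨x, hx, rfl⟩ ⟨y, hy, rfl⟩
        exact ⟨x + y, Submodule.add_mem _ hx hy, map_add _ _ _⟩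
      · intro i hi f y
        exact ⟨((gen V S).toMod.map f).hom ⟨y.1, mem_gen (hS hi.le hj) y.1⟩,
          map_mem_idealMul hi f _, rfl⟩
    obtain ⟨a', ha', e⟩ := key
    rwa [← (isSES_layer V S n).inj j e]
  · obtain ⟨x, hx⟩ := a
    have key : ∃ a ∈ idealMul (gen V S).toMod j, a.1 = x := by
      refine gen_induction (p := fun x => ∃ a ∈ idealMul (gen V S).toMod j, a.1 = x) hx
        ⟨0, Submodule.zero_mem _, rfl⟩ ?_ ?_
      · rintro _ _ ⟨x, hx, rfl⟩ ⟨y, hy, rfl⟩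
        exact ⟨x + y, Submodule.add_mem _ hx hy, rfl⟩
      · intro i hi f y
        have hij : i.size < j.size := size_lt_of_hom f fun e => hj (e ▸ hi)
        exact ⟨((gen V S).toMod.map f).hom ⟨y, mem_gen hi y⟩, map_mem_idealMul hij f _, rfl⟩
    obtain ⟨a, ha', e⟩ := key
    have : a = ⟨x, hx⟩ := Subtype.ext e
    rwa [← this]

/-- If `H_1` of the submodule generated in `S ∪ {n}` vanishes on `L`, then so does `H_1` of the
submodule generated in `S`, and the quotient is basic relative projective on `L`. -/
lemma peel (hS : Down S) {L : Set (FIm m)} (hL : Down L)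
    (h : ∀ j ∈ L, Acyc 1 (gen V (insert n S)).toMod j) :
    (∀ j ∈ L, Acyc 1 (gen V S).toMod j) ∧
      ∀ j ∈ L, Function.Injective ((counit (layer V S n) n).app j).hom := by
  have hC : ∀ j ∈ L, Acyc 1 (layer V S n) j := fun j hj =>
    acyc_one_right (isSES_layer V S n) (h j hj) (mem_idealMul_gen hS)
  let β := counit (layer V S n) n
  have hβ := isSES_kerSub β layer_counit_surjective
  -- The kernel of the cover is zero at `n`; at other objects of `L`, `H_1(layer) = 0` embeds its
  -- `H_0` in that of the basic module, which is zero there. Nakayama finishes.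
  have hK : ∀ j ∈ L, ∀ x : (kerSub β).toMod.obj j, x = 0 := by
    refine eq_zero_of_idealMul hL fun j hj x _ => ?_
    by_cases hjn : j = n
    · subst hjn
      refine Or.inl (Subtype.ext (counit_injective_self _ _ ?_))
      exact Eq.trans x.2 (map_zero _).symm
    · refine Or.inr (mem_idealMul_of_acyc_one hβ (hC j hj) x ?_)
      rw [idealMul_basic_of_ne _ hjn]
      trivial
  refine ⟨fun j hj => acyc_one_left (isSES_layer V S n) ?_ (h j hj), fun j hj => ?_⟩
  -- On `L` the cover is an isomorphism, so `H_2` of the layer vanishes there, as `acyc_one_left`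
  -- requires.
  · exact acyc_right hβ 0 (acyc_basic 1 n j _) (acyc_of_eq_zero 0 fun i hi => hK i (hL hi hj))
  · rw [injective_iff_map_eq_zero]
    intro x hx
    exact congrArg Subtype.val (hK j hj ⟨x, hx⟩)

end Peel

/-- An object of maximal degree in `T \ S` lies below no other object of `T`, so removing it keeps
the set downward closed. -/
lemma Down.exists_peel {S T : Set (FIm m)} (hS : Down S) (hT : Down T) (hST : S ⊆ T)
    (hfin : (T \ S).Finite) (hne : (T \ S).Nonempty) :
    ∃ n ∈ T \ S, Down (T \ {n}) ∧ S ⊆ T \ {n} ∧ insert n (T \ {n}) = T ∧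
      ((T \ {n}) \ S).ncard < (T \ S).ncard := by
  obtain ⟨n, hn, hmax⟩ := Set.exists_max_image _ deg hfin hne
  refine ⟨n, hn, fun i j hij hj => ⟨hT hij hj.1, ?_⟩, fun j hj => ⟨hST hj, ?_⟩,
    Set.insert_sdiff_self_of_mem hn.1, Set.ncard_lt_ncard ⟨?_, ?_⟩ hfin⟩
  · rintro rfl
    have hjS : j ∉ S := fun h => hn.2 (hS hij h)
    have hlt : i.size < j.size := lt_of_le_of_ne hij fun e => hj.2 (FIm.ext e.symm)
    exact absurd (hmax j ⟨hj.1, hjS⟩) (not_le_of_gt (deg_lt_of_size_lt hlt))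
  · rintro rfl
    exact hn.2 hj
  · exact Set.sdiff_subset_sdiff_left Set.sdiff_subset
  · exact fun h => (h hn).1.2 rfl

lemma acyc_gen_of_subset {V : Mod m k} {S L : Set (FIm m)} (hS : Down S) (hL : Down L) :
    ∀ (N : ℕ) (T : Set (FIm m)), Down T → S ⊆ T → (T \ S).Finite → (T \ S).ncard = N →
      (∀ j ∈ L, Acyc 1 (gen V T).toMod j) → ∀ j ∈ L, Acyc 1 (gen V S).toMod j := by
  intro N
  induction N using Nat.strong_induction_on with
  | _ N ih =>
    intro T hT hST hfin hN h
    by_cases hne : (T \ S).Nonempty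
    · obtain ⟨n, hn, hD, hS', hins, hcard⟩ := hS.exists_peel hT hST hfin hne
      refine ih _ (hN ▸ hcard) _ hD hS'
        (hfin.subset (Set.sdiff_subset_sdiff_left Set.sdiff_subset)) rfl ?_
      refine (peel (n := n) hD hL ?_).1
      rwa [hins]
    · have : T = S := Set.Subset.antisymm
        (Set.sdiff_eq_empty.1 (Set.not_nonempty_iff_eq_empty.1 hne)) hST
      rwa [← this]

/-! ### The alternating operator -/

/-- The object obtained by doubling all sizes. -/
def double (n : FIm m) : FIm m := ⟨fun i => n.size i * 2⟩

lemma size_le_double (n : FIm m) : n.size ≤ (double n).size := fun i =>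
  Nat.le_mul_of_pos_right (n.size i) two_pos

/-- A choice of one of two copies for every point. -/
abbrev Choice (n : FIm m) : Type := (Σ i, Fin (n.size i)) → Fin 2

/-- The embedding of `n` into its double selecting the prescribed copies. -/
def doubleHom {n : FIm m} (s : Choice n) : n ⟶ double n := fun i =>
  ⟨fun a => finProdFinEquiv (a, s ⟨i, a⟩), fun a b h => by
    have := finProdFinEquiv.injective h
    exact (Prod.ext_iff.1 this).1⟩

lemma doubleHom_apply {n : FIm m} (s : Choice n) (i : Fin m) (a : Fin (n.size i)) :
    doubleHom s i a = finProdFinEquiv (a, s ⟨i, a⟩) := rfl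

variable (k) in
/-- The sign of a choice. -/
def choiceSign {n : FIm m} (s : Choice n) : k := ∏ p, (-1) ^ (s p : ℕ)

lemma choiceSign_zero {n : FIm m} : choiceSign k (0 : Choice n) = 1 := by
  simp [choiceSign]

lemma choiceSign_update {n : FIm m} (s : Choice n) (p : Σ i, Fin (n.size i)) :
    choiceSign k (Function.update s p (Fin.rev (s p))) = - choiceSign k s := by
  classical
  unfold choiceSign
  rw [← Finset.mul_prod_erase _ _ (Finset.mem_univ p), ← Finset.mul_prod_erase
    (a := p) _ (fun p => (-1 : k) ^ (s p : ℕ)) (Finset.mem_univ p), Function.update_self,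
    Finset.prod_congr rfl (g := fun p => (-1 : k) ^ (s p : ℕ)) fun q hq => by
      rw [Function.update_of_ne (Finset.ne_of_mem_erase hq)]]
  have h : ∀ c : Fin 2, (-1 : k) ^ (Fin.rev c : ℕ) = - (-1) ^ (c : ℕ) := by
    intro c
    fin_cases c <;> simp
  rw [h, neg_mul]

/-- The alternating sum of the maps `V_n → V_{2n}` induced by all choices. -/
def alternating (V : Mod m k) (n : FIm m) : V.obj n →ₗ[k] V.obj (double n) :=
  ∑ s : Choice n, choiceSign k s • (V.map (doubleHom s)).hom

lemma alternating_apply (V : Mod m k) {n : FIm m} (x : V.obj n) :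
    alternating V n x = ∑ s : Choice n, choiceSign k s • (V.map (doubleHom s)).hom x := by
  simp [alternating]

lemma app_alternating {V W : Mod m k} (φ : V ⟶ W) {n : FIm m} (x : V.obj n) :
    (φ.app (double n)).hom (alternating V n x) = alternating W n ((φ.app n).hom x) := by
  rw [alternating_apply, alternating_apply, map_sum]
  refine Finset.sum_congr rfl fun s _ => ?_
  rw [map_smul]
  exact congrArg _ (NatTrans.naturality_apply φ _ x)

/-- The alternating operator kills `𝔪V`. -/
lemma alternating_eq_zero {V : Mod m k} {n : FIm m} {x : V.obj n} (hx : x ∈ idealMul V n) :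
    alternating V n x = 0 := by
  classical
  refine idealMul_induction (p := fun x => alternating V n x = 0) hx (map_zero _)
    (fun x y hx hy => by rw [map_add, hx, hy, add_zero]) fun j hj g y => ?_
  -- Since `j < n`, some point `a` is missed by `g`. Flipping the copy chosen for `a` leaves the
  -- composite with `g` unchanged and reverses the sign, so the terms cancel in pairs.
  obtain ⟨i, hi⟩ := (Pi.lt_def.1 hj).2
  obtain ⟨a, ha⟩ : ∃ a, a ∉ Set.range (g i) := by
    by_contra! h
    have := Fintype.card_le_of_surjective (g i) h
    simp only [Fintype.card_fin] at this
    omega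
  rw [alternating_apply]
  refine Finset.sum_involution
    (fun s _ => Function.update s ⟨i, a⟩ (Fin.rev (s ⟨i, a⟩))) ?_ ?_ ?_ ?_
  · intro s _
    have h : g ≫ doubleHom (Function.update s ⟨i, a⟩ (Fin.rev (s ⟨i, a⟩))) = g ≫ doubleHom s := by
      refine hom_ext fun i' b => ?_
      rw [comp_apply, comp_apply, doubleHom_apply, doubleHom_apply, Function.update_of_ne]
      intro e
      obtain ⟨rfl, e⟩ := Sigma.mk.inj_iff.1 e
      exact ha ⟨b, eq_of_heq e⟩
    have h' : ∀ s, (V.map (doubleHom s)).hom ((V.map g).hom y) = (V.map (g ≫ doubleHom s)).hom y :=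
      fun s => by simp
    rw [h', h', h, choiceSign_update, neg_smul, add_neg_cancel]
  · intro s _ _ e
    have := congrFun e ⟨i, a⟩
    rw [Function.update_self] at this
    revert this
    generalize s ⟨i, a⟩ = c
    revert c
    decide
  · intro s _
    exact Finset.mem_univ _
  · intro s _
    simp

/-- The alternating operator is injective at `n` on basic modules `M(n) ⊗_{kS_n} U`. -/
lemma basicCoord_alternating {n : FIm m} {U : Type u} [AddCommGroup U] [Module k U]
    (ρ : Representation k (CategoryTheory.End n) U) (u : U) :
    basicCoord ρ (doubleHom 0) (alternating (basic n ρ) n (basicMk ρ (𝟙 n) u)) = u := by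
  rw [alternating_apply, map_sum, Finset.sum_eq_single (0 : Choice n)]
  · rw [choiceSign_zero, one_smul, map_basicMk, Category.id_comp, basicCoord_self]
  · intro s _ hs
    rw [map_smul, map_basicMk, Category.id_comp, basicCoord_of_not_exists, smul_zero]
    -- The copies in the image of `doubleHom s` determine `s`, so distinct choices lie in distinct
    -- orbits.
    rintro ⟨σ, hσ⟩
    refine hs (funext fun ⟨i, a⟩ => ?_)
    have h := DFunLike.congr_fun (congrFun hσ i) a
    rw [comp_apply, doubleHom_apply, doubleHom_apply] at h
    exact (Prod.ext_iff.1 (finProdFinEquiv.injective h)).2.symm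
  · simp

/-- By naturality the equation lifts along the counit to the basic module, where the operator is
injective at `n`. Injectivity of the counit is needed at `2n`, where the operator takes its values.
-/
lemma eq_zero_of_alternating {V : Mod m k} {n : FIm m}
    (h : Function.Injective ((counit V n).app (double n)).hom) {x : V.obj n}
    (hx : alternating V n x = 0) : x = 0 := by
  have h1 : ((counit V n).app n).hom (basicMk (endRep V n) (𝟙 n) x) = x := by
    rw [counit_basicMk, V.map_id]
    rfl
  rw [← h1, ← app_alternating] at hx
  rw [← basicCoord_alternating (endRep V n) x, h (hx.trans (map_zero _).symm), map_zero]

/-! ### Descent from higher homology to `H_1` -/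

lemma finite_setOf_size_le (n : FIm m) : {j : FIm m | j.size ≤ n.size}.Finite :=
  (Set.finite_Iic n.size).preimage fun _ _ _ _ h => FIm.ext h

/-- If `H_1(V) = 0`, the kernel of the alternating operator is `𝔪V`. -/
theorem mem_idealMul_of_alternating {V : Mod m k} (hV : ∀ j, Acyc 1 V j) {n : FIm m} {x : V.obj n}
    (hx : alternating V n x = 0) : x ∈ idealMul V n := by
  -- Nothing beyond `2n` matters, and `L` is finite, so peeling works without any bound on the
  -- generating degree of `V`.
  let L : Set (FIm m) := {j | j.size ≤ (double n).size}
  let T : Set (FIm m) := {j | j.size ≤ n.size}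
  let S : Set (FIm m) := {j | j.size < n.size}
  have hL : Down L := fun i j hij hj => le_trans hij hj
  have hT : Down T := fun i j hij hj => le_trans hij hj
  have hS : Down S := fun i j hij hj => lt_of_le_of_lt hij hj
  have hTS : T = insert n S := by
    ext j
    change j.size ≤ n.size ↔ j = n ∨ j.size < n.size
    rw [le_iff_eq_or_lt, FIm.ext_iff]
  have h1 : ∀ j ∈ L, Acyc 1 (gen V L).toMod j := fun j hj => by
    -- The submodule generated on `L` agrees with `V` on `L`, so the quotient is zero there and has
    -- no `H_2`.
    refine acyc_one_left (gen V L).isSES (acyc_of_eq_zero 1 fun i hi x => ?_) (hV j)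
    obtain ⟨x, rfl⟩ := (gen V L).isSES.surj i x
    exact (Submodule.Quotient.mk_eq_zero _).2 (mem_gen (hL hi hj) x)
  have h2 : ∀ j ∈ L, Acyc 1 (gen V T).toMod j :=
    acyc_gen_of_subset hT hL _ L hL (fun j hj => le_trans hj (size_le_double n))
      ((finite_setOf_size_le (double n)).subset Set.sdiff_subset) rfl h1
  rw [hTS] at h2
  have h3 := (peel hS hL h2).2 (double n) (le_refl (double n).size)
  let y : (gen V (insert n S)).toMod.obj n := ⟨x, mem_gen (Set.mem_insert n S) x⟩
  have hy : alternating (gen V (insert n S)).toMod n y = 0 := by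
    apply (gen V (insert n S)).isSES.inj
    rw [app_alternating, map_zero]
    exact hx
  have h4 := eq_zero_of_alternating h3
    (x := (((gen V S).relative (gen V (insert n S))).π.app n).hom y)
    (by rw [← app_alternating, hy, map_zero])
  -- The submodule generated by the objects strictly below `n` is, at `n`, `𝔪V` by definition.
  exact (Submodule.Quotient.mk_eq_zero (((gen V S).relative (gen V (insert n S))).carrier n)).1 h4

/-- Vanishing of `H_2` implies vanishing of `H_1`. -/
lemma acyc_one_of_syzygy {K P V : Mod m k} [Projective P] {i : K ⟶ P} {p : P ⟶ V}
    (h : IsSES i p) (hK : ∀ j, Acyc 1 K j) (j : FIm m) : Acyc 1 V j := by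
  rw [acyc_one_iff h]
  intro x hx
  -- The operator kills the image of `x` in `P`, which lies in `𝔪P`; injectivity of `K → P` at `2n`
  -- brings this back to `K`.
  refine mem_idealMul_of_alternating hK (h.inj _ ?_)
  rw [app_alternating, alternating_eq_zero hx, map_zero]

/-- Vanishing passes to the syzygy one degree lower; induction gives `H_1 = 0` for the syzygy, and
the alternating operator returns it to `V`. -/
theorem acyc_one_of_acyc (s : ℕ) : ∀ {V : Mod m k}, (∀ j, Acyc (s + 1) V j) →
    ∀ j, Acyc 1 V j := by
  induction s with
  | zero => exact fun h => h
  | succ s ih =>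
    intro V h
    have hSES := isSES_kerSub _ (coverMap_surjective V)
    exact acyc_one_of_syzygy hSES (ih fun j => (acyc_succ_succ_iff hSES s j).1 (h j))

/-! ### Filtrations -/

/-- `Y / X` is basic relative projective. -/
def IsBasicStep {V : Mod m k} (X Y : Subobject V) : Prop :=
  ∃ h : X ≤ Y, IsBasicRelativeProjective (cokernel (Subobject.ofLE X Y h))

lemma isSES_of_shortExact {S : ShortComplex (Mod m k)} (h : S.ShortExact) : IsSES S.f S.g where
  inj t := by
    have := h.mono_f
    exact (ModuleCat.mono_iff_injective _).1 inferInstance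
  surj t := by
    have := h.epi_g
    exact surjective_of_epi _ t
  exact t x := by
    refine ⟨forall_of_exact h.exact t x, ?_⟩
    rintro ⟨y, rfl⟩
    exact congrArg (fun φ => (φ.app t).hom y) S.zero

lemma isSES_cokernel {A B : Mod m k} (i : A ⟶ B) [Mono i] : IsSES i (cokernel.π i) :=
  isSES_of_shortExact (S := ShortComplex.mk i (cokernel.π i) (cokernel.condition i))
    { exact := ShortComplex.exact_cokernel i }

/-- Relative projective modules are acyclic. -/
theorem acyc_of_isRelativeProjective {V : Mod m k} (h : IsRelativeProjective V) (s : ℕ)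
    (j : FIm m) : Acyc (s + 1) V j := by
  obtain ⟨r, F, hF, h0, hr, hq⟩ := h
  have key : ∀ i ≤ r, Acyc (s + 1) (F i : Mod m k) j := by
    intro i
    induction i with
    | zero =>
      intro _
      have hz : IsZero ((F 0 : Subobject V) : Mod m k) := by
        rw [h0]
        exact IsZero.of_iso (isZero_zero _) Subobject.botCoeIsoZero
      refine acyc_of_eq_zero s fun i _ x => ?_
      have : Subsingleton (((F 0 : Subobject V) : Mod m k).obj i) :=
        ModuleCat.isZero_iff_subsingleton.1 ((Functor.isZero_iff _).1 hz i)
      exact Subsingleton.elim _ _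
    | succ i ih =>
      intro hi
      obtain ⟨n, U, ρ, ⟨e⟩⟩ := hq i hi
      exact (acyc_two_out_of_three s j (isSES_cokernel (Subobject.ofLE _ _ (hF (Nat.le_succ i))))).1
        (ih (Nat.le_of_succ_le hi)) ((acyc_basic s n j ρ).of_iso e.symm)
  have := key r le_rfl
  rw [hr] at this
  exact this.of_iso (asIso (⊤ : Subobject V).arrow)

/-! ### From families of submodules to subobjects and their cokernels -/

instance {V : Mod m k} (N : SubMod V) : Mono N.ι := mono_of_injective _ N.isSES.inj

/-- The subobject given by a submodule. -/
abbrev SubMod.toSubobject {V : Mod m k} (N : SubMod V) : Subobject V := Subobject.mk N.ι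

lemma exists_cokernel_ofLE_iso {C : Type*} [Category* C] [Abelian C] {A B X : C} {f : A ⟶ X}
    {g : B ⟶ X} [Mono f] [Mono g] (i : A ⟶ B) (hi : i ≫ g = f) :
    ∃ h : Subobject.mk f ≤ Subobject.mk g,
      Nonempty (cokernel (Subobject.ofLE _ _ h) ≅ cokernel i) := by
  refine ⟨Subobject.mk_le_mk_of_comm i hi, ⟨cokernel.mapIso _ i (Subobject.underlyingIso f)
    (Subobject.underlyingIso g) ?_⟩⟩
  rw [← cancel_mono g, Category.assoc, Category.assoc, hi,
    Subobject.underlyingIso_hom_comp_eq_mk, Subobject.underlyingIso_hom_comp_eq_mk,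
    Subobject.ofLE_arrow]

lemma isIso_of_bijective {V W : Mod m k} (φ : V ⟶ W)
    (h : ∀ t, Function.Bijective (φ.app t).hom) : IsIso φ := by
  have := mono_of_injective φ fun t => (h t).1
  have := epi_of_surjective φ fun t => (h t).2
  exact isIso_of_mono_of_epi φ

lemma nonempty_cokernel_iso {A B C : Mod m k} {i : A ⟶ B} {p : B ⟶ C} (h : IsSES i p) :
    Nonempty (cokernel i ≅ C) := by
  let S : ShortComplex (Mod m k) := ShortComplex.mk i p (by
    ext t x
    exact (h.exact t).apply_apply_eq_zero _)
  have hS : S.Exact := exact_of_forall fun t x hx => (h.exact t x).1 hx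
  have : Epi S.g := epi_of_surjective p h.surj
  exact ⟨(colimit.isColimit _).coconePointUniqueUpToIso hS.gIsCokernel⟩

lemma SubMod.incl_comp_ι {V : Mod m k} {N N' : SubMod V}
    (h : ∀ t, N.carrier t ≤ N'.carrier t) : SubMod.incl h ≫ N'.ι = N.ι := by
  ext t x
  rfl

lemma nonempty_layer_iso {V : Mod m k} {S : Set (FIm m)} {n : FIm m} (hS : Down S)
    (h : ∀ j, Acyc 1 (gen V (insert n S)).toMod j) :
    Nonempty (layer V S n ≅ basic n (endRep (layer V S n) n)) := by
  have hinj := (peel (L := Set.univ) hS (fun _ _ _ _ => trivial) fun j _ => h j).2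
  have := isIso_of_bijective (counit (layer V S n) n) fun t =>
    ⟨hinj t trivial, layer_counit_surjective t⟩
  exact ⟨(asIso (counit (layer V S n) n)).symm⟩

lemma isBasicStep_gen {V : Mod m k} {S : Set (FIm m)} {n : FIm m} (hS : Down S)
    (h : ∀ j, Acyc 1 (gen V (insert n S)).toMod j) :
    IsBasicStep (gen V S).toSubobject (gen V (insert n S)).toSubobject := by
  obtain ⟨hle, ⟨e⟩⟩ := exists_cokernel_ofLE_iso _
    (SubMod.incl_comp_ι (gen_mono V (Set.subset_insert n S)))
  obtain ⟨e1⟩ := nonempty_cokernel_iso (isSES_layer V S n)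
  obtain ⟨e2⟩ := nonempty_layer_iso hS h
  exact ⟨hle, n, (layer V S n).obj n, endRep _ n, ⟨e ≪≫ e1 ≪≫ e2⟩⟩

lemma toSubobject_gen_empty (V : Mod m k) : (gen V ∅).toSubobject = ⊥ := by
  refine Subobject.mk_eq_bot_iff_zero.2 ?_
  ext t x
  exact gen_induction (p := fun x => x = 0) x.2 rfl (by rintro _ _ rfl rfl; exact add_zero 0)
    fun j hj => hj.elim

/-- Each peeled object contributes the top factor of the filtration. The filtration is constant from
`r` on, which later yields monotonicity on all of `ℕ`. -/
lemma exists_filtration {V : Mod m k} (N : ℕ) : ∀ T : Set (FIm m), T.Finite → T.ncard = N → Down T →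
    (∀ j, Acyc 1 (gen V T).toMod j) →
    ∃ (r : ℕ) (F : ℕ → Subobject V), F 0 = ⊥ ∧ (∀ i, r ≤ i → F i = (gen V T).toSubobject) ∧
      ∀ i < r, IsBasicStep (F i) (F (i + 1)) := by
  induction N using Nat.strong_induction_on with
  | _ N ih =>
    intro T hfin hN hT h
    rcases T.eq_empty_or_nonempty with rfl | hne
    · exact ⟨0, fun _ => ⊥, rfl, fun _ _ => (toSubobject_gen_empty V).symm,
        fun i hi => absurd hi (Nat.not_lt_zero i)⟩
    · have hE : Down (∅ : Set (FIm m)) := fun _ _ _ h => h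
      obtain ⟨n, hn, hD, -, hins, hcard⟩ := hE.exists_peel hT (Set.empty_subset T)
        (hfin.subset Set.sdiff_subset) (by rwa [Set.sdiff_empty])
      rw [Set.sdiff_empty, Set.sdiff_empty, hN] at hcard
      rw [← hins] at h
      have hstep := isBasicStep_gen hD h
      have hacyc := (peel (L := Set.univ) hD (fun _ _ _ _ => trivial) fun j _ => h j).1
      rw [hins] at hstep
      obtain ⟨r, F, h0, hr, hF⟩ := ih _ hcard _ (hfin.subset Set.sdiff_subset) rfl hD
        fun j => hacyc j trivial
      refine ⟨r + 1, fun i => if i ≤ r then F i else (gen V T).toSubobject, ?_, ?_, ?_⟩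
      · simpa using h0
      · intro i hi
        exact if_neg (not_le_of_gt hi)
      · intro i hi
        rcases Nat.lt_succ_iff_lt_or_eq.1 hi with hi | rfl
        · simpa [hi.le, Nat.succ_le_of_lt hi] using hF i hi
        · simpa [hr i le_rfl] using hstep

lemma exists_idealMul_eq_top {V : Mod m k} (hV : gd V < ⊤) :
    ∃ d : ℕ, ∀ n : FIm m, d ≤ n.deg → idealMul V n = ⊤ := by
  -- Any natural number above a real bound for `gd V` serves as `d`.
  obtain ⟨r, hr, -⟩ := EReal.lt_iff_exists_real_btwn.1 hV
  obtain ⟨d, hd⟩ := exists_nat_gt r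
  refine ⟨d, fun n hn => idealMul_eq_top_of_acyc_zero ?_⟩
  by_contra hne
  have h1 : ((n.deg : ℕ) : EReal) ≤ gd V := le_sSup (Set.mem_insert_of_mem _ ⟨n, hne, rfl⟩)
  have h2 : ((n.deg : ℕ) : EReal) < ((r : ℝ) : EReal) := h1.trans_lt hr
  have h3 : (n.deg : ℝ) < r := by exact_mod_cast h2
  have h4 : (d : ℝ) ≤ n.deg := by exact_mod_cast hn
  linarith

/-- From degree `d` on every element is a sum of images from strictly lower degree, so induction on
degree descends below `d`. -/
lemma gen_eq_top {V : Mod m k} {d : ℕ} (hd : ∀ n : FIm m, d ≤ n.deg → idealMul V n = ⊤)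
    (j : FIm m) : ∀ x : V.obj j, x ∈ (gen V {j | j.deg < d}).carrier j := by
  induction hD : j.deg using Nat.strong_induction_on generalizing j with
  | _ D ih =>
    subst hD
    intro x
    by_cases hj : j.deg < d
    · exact mem_gen hj x
    · refine idealMul_induction (p := fun x => x ∈ (gen V {j | j.deg < d}).carrier j) (x := x)
        (by rw [hd j (not_lt.1 hj)]; trivial) (Submodule.zero_mem _)
        (fun x y => Submodule.add_mem _) fun i hi f y => ?_
      exact (gen V _).map_mem f y (ih _ (deg_lt_of_size_lt hi) i rfl y)

lemma finite_setOf_deg_lt (d : ℕ) : {j : FIm m | j.deg < d}.Finite :=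
  (finite_setOf_size_le (⟨fun _ => d⟩ : FIm m)).subset fun j hj i =>
    (Finset.single_le_sum (f := j.size) (fun _ _ => Nat.zero_le _) (Finset.mem_univ i)).trans hj.le

lemma down_setOf_deg_lt (d : ℕ) : Down {j : FIm m | j.deg < d} := fun _ _ hij hj =>
  lt_of_le_of_lt (Finset.sum_le_sum fun b _ => hij b) hj

/-- A module of finite generating degree with `H_1(V) = 0` is relative projective. -/
theorem isRelativeProjective_of_acyc {V : Mod m k} (hV : gd V < ⊤) (h : ∀ j, Acyc 1 V j) :
    IsRelativeProjective V := by
  obtain ⟨d, hd⟩ := exists_idealMul_eq_top hV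
  let T : Set (FIm m) := {j | j.deg < d}
  have hiso : IsIso (gen V T).ι := isIso_of_bijective _ fun t =>
    ⟨(gen V T).isSES.inj t, fun x => ⟨⟨x, gen_eq_top hd t x⟩, rfl⟩⟩
  obtain ⟨r, F, h0, hr, hF⟩ := exists_filtration _ T (finite_setOf_deg_lt d) rfl
    (down_setOf_deg_lt d) fun j => (h j).of_iso (asIso (gen V T).ι).symm
  have hmono : Monotone F := monotone_nat_of_le_succ fun i => by
    rcases lt_or_ge i r with hi | hi
    · exact (hF i hi).1
    · rw [hr i hi, hr (i + 1) (Nat.le_succ_of_le hi)]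
  refine ⟨r, F, hmono, h0, ?_, fun i hi => (hF i hi).2⟩
  rw [hr r le_rfl]
  exact Subobject.mk_eq_top_of_isIso _

end FIm

end

/-! ### The equivalence -/

theorem theorem1p3 (m : ℕ) (hm : 0 < m) (k : Type u) [CommRing k] (V : FIm.Mod m k)
    (hV : FIm.gd V < ⊤) :
    List.TFAE [
      FIm.IsRelativeProjective V,
      ∀ s : ℕ, 1 ≤ s → IsZero (FIm.homology s V),
      IsZero (FIm.homology 1 V),
      ∃ s : ℕ, 1 ≤ s ∧ IsZero (FIm.homology s V)] := by
  tfae_have 1 → 2 := by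
    intro h s hs
    obtain ⟨s, rfl⟩ := Nat.exists_eq_add_of_le' hs
    exact (FIm.isZero_iff_acyc _ _).2 (FIm.acyc_of_isRelativeProjective h s)
  tfae_have 2 → 3 := fun h => h 1 le_rfl
  tfae_have 3 → 4 := fun h => ⟨1, le_rfl, h⟩
  tfae_have 4 → 1 := by
    rintro ⟨s, hs, h⟩
    obtain ⟨s, rfl⟩ := Nat.exists_eq_add_of_le' hs
    exact FIm.isRelativeProjective_of_acyc hV
      (FIm.acyc_one_of_acyc s ((FIm.isZero_iff_acyc _ _).1 h))
  tfae_finish
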